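/- A cell is a unit cube of the cubic lattice, and a ($3D$) polyomino is a nonempty finite set of cells that is connected through faces. It is inscribed in a $b\times k\times h$ prism if it is contained in the prism and touches each of its six faces. A corner-polyomino is an inscribed polyomino of minimal volume (among all polyominoes inscribed in the same prism) that contains the cell in one fixed corner of the prism. Let $p_c(b,k,h)$ be the number of corner-polyominoes inscribed in a $b\times k\times h$ prism. Consider also the following families, each with its generating function $\sum_{b,k,h\ge 1} a(b,k,h)x^by^kz^h$, where $a(b,k,h)$ is the number of members in the $b\times k\times h$ prism: - $\mathrm{Stair}$: the $3D$ stairs, i.e. the minimal inscribed polyominoes that form a path from the fixed corner to the opposite corner by unit steps in the three directions leading away from the fixed corner; - $\mathrm{Tripod}$: the corner-polyominoes whose corner cell has degree $3$ (the degree of a cell is the number of cells of the polyomino that share a face with it); - $\mathrm{Deg2}$: the corner-polyominoes with $b,k,h\ge 2$ whose corner cell has degree $2$; - $\mathrm{2Dhook}$: the $2D$ hooks, i.e. in a prism with one side of length $1$ and two sides of length at least $2$, the union of the two full rows of cells along edges that meet in the fixed corner. Then $$\sum_{b,k,h\ge1}p_c(b,k,h)\,x^by^kz^h=\mathrm{Stair}(x,y,z)\left[1+\frac{\mathrm{Tripod}(x,y,z)+\mathrm{Deg2}(x,y,z)+\mathrm{2Dhook}(x,y,z)}{xyz}\right],$$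 where $$\mathrm{Stair}=\frac{xyz}{1-x-y-z},\qquad \mathrm{Tripod}=\frac{x^2y^2z^2}{(1-x)(1-y)(1-z)},$$ $$\mathrm{2Dhook}=\frac{x^2y^2z}{(1-x)(1-y)}+\frac{x^2yz^2}{(1-x)(1-z)}+\frac{xy^2z^2}{(1-z)(1-y)},$$ $$\mathrm{Deg2}=\left[\frac{2yz}{1-y-z}-\frac{2yz}{(1-y)(1-z)}\right]\frac{x^2}{1-x}+\left[\frac{2xz}{1-x-z}-\frac{2xz}{(1-x)(1-z)}\right]\frac{y^2}{1-y}+\left[\frac{2xy}{1-x-y}-\frac{2xy}{(1-x)(1-y)}\right]\frac{z^2}{1-z}.$$ -/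

import Mathlib

/-- A unit cubic cell of the discrete space, named by its integer coordinates along the three
axes. -/
abbrev Cell : Type := Fin 3 → ℤ

/-- Two cells are adjacent when they have a common face. -/
def cellGraph : SimpleGraph Cell where
  Adj u v := ∑ i, |u i - v i| = 1
  symm := ⟨fun u v h => by simpa only [abs_sub_comm] using h⟩
  loopless := ⟨fun u h => by simp at h⟩

/-- A polyomino in dimension three: a nonempty finite set of cells that is connected through
faces. -/
def IsPolyomino (S : Finset Cell) : Prop :=
  (cellGraph.induce (S : Set Cell)).Connected

/-- `u` is a cell of the prism of size `n 0 × n 1 × n 2`. The coordinates are chosen such that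
the given corner of the prism is the cell `0` and that the axes point into the prism. -/
def InPrism (n : Fin 3 → ℕ) (u : Cell) : Prop :=
  ∀ i, 0 ≤ u i ∧ u i < (n i : ℤ)

/-- The polyomino `S` is inscribed in the prism: it is contained in the prism and touches each
of its six faces. -/
def IsInscribed (n : Fin 3 → ℕ) (S : Finset Cell) : Prop :=
  IsPolyomino S ∧ (∀ u ∈ S, InPrism n u) ∧
    ∀ i, (∃ u ∈ S, u i = 0) ∧ ∃ u ∈ S, u i = (n i : ℤ) - 1

/-- `S` is an inscribed polyomino of minimal volume. -/
def IsMinimalInscribed (n : Fin 3 → ℕ) (S : Finset Cell) : Prop :=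
  IsInscribed n S ∧ ∀ T, IsInscribed n T → S.card ≤ T.card

/-- Corner-polyominoes: minimal inscribed polyominoes with a cell in the given corner. -/
def IsCornerPolyomino (n : Fin 3 → ℕ) (S : Finset Cell) : Prop :=
  IsMinimalInscribed n S ∧ (0 : Cell) ∈ S

/-- The degree of the cell `u` in `S`: the number of cells of `S` in face contact with `u`. -/
noncomputable def cellDegree (S : Finset Cell) (u : Cell) : ℕ :=
  {v : Cell | v ∈ S ∧ cellGraph.Adj u v}.ncard

/-- Stairs: minimal inscribed polyominoes forming a path from the given corner to the opposite
corner by unit steps in the positive directions. -/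
def IsStair (n : Fin 3 → ℕ) (S : Finset Cell) : Prop :=
  IsMinimalInscribed n S ∧ ∃ (N : ℕ) (p : ℕ → Cell),
    p 0 = 0 ∧ (∀ i, p N i = (n i : ℤ) - 1) ∧
    (∀ t < N, ∃ i : Fin 3, p (t + 1) = p t + Pi.single i 1) ∧
    S = (Finset.range (N + 1)).image p

/-- Tripods: corner-polyominoes whose corner cell has degree three. -/
def IsTripod (n : Fin 3 → ℕ) (S : Finset Cell) : Prop :=
  IsCornerPolyomino n S ∧ cellDegree S 0 = 3

/-- Properly three-dimensional corner-polyominoes (no side of the prism has length one) whose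
corner cell has degree two. -/
def IsDegTwoCorner (n : Fin 3 → ℕ) (S : Finset Cell) : Prop :=
  (∀ i, 2 ≤ n i) ∧ IsCornerPolyomino n S ∧ cellDegree S 0 = 2

/-- Flat hooks: in a prism with one side of length one and two sides, along the axes `i` and
`j`, of length at least two, the two rows of cells along the edges of the prism that meet in the
given corner. -/
def IsFlatHook (n : Fin 3 → ℕ) (S : Finset Cell) : Prop :=
  ∃ i j : Fin 3, i ≠ j ∧ 2 ≤ n i ∧ 2 ≤ n j ∧ (∀ l, l ≠ i → l ≠ j → n l = 1) ∧
    ∀ u : Cell, u ∈ S ↔ InPrism n u ∧ (u i = 0 ∨ u j = 0)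

/-- The number of members of a family `F` of inscribed sets of cells in the prism of size `n`. -/
noncomputable def familyCount (F : (Fin 3 → ℕ) → Finset Cell → Prop) (n : Fin 3 → ℕ) : ℕ :=
  {S : Finset Cell | F n S}.ncard

/-- The sets counted are finite, so that `Set.ncard` is the number of elements. -/
theorem finite_inPrism (n : Fin 3 → ℕ) :
    {S : Finset Cell | ∀ u ∈ S, InPrism n u}.Finite := by
  have h : {u : Cell | InPrism n u}.Finite := by
    refine (Set.finite_Icc (0 : Cell) (fun i => (n i : ℤ))).subset ?_
    intro u hu
    exact ⟨fun i => (hu i).1, fun i => (hu i).2.le⟩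
  refine ((h.toFinset.powerset : Finset (Finset Cell)).finite_toSet).subset ?_
  intro S hS
  simp only [Finset.coe_powerset, Set.mem_preimage, Set.mem_powerset_iff]
  intro u hu
  simpa using hS u hu

/-- The generating function `∑ p(b,k,h) x^b y^k z^h`, over `b, k, h ≥ 1`, of a family. -/
noncomputable def genFun (F : (Fin 3 → ℕ) → Finset Cell → Prop) : MvPowerSeries (Fin 3) ℚ :=
  fun m => if ∀ i, 1 ≤ m i then (familyCount F m : ℚ) else 0

section RationalFunctions

variable {K : Type*} [Field K]

def stairFun (x y z : K) : K := x * y * z / (1 - x - y - z)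

def tripodFun (x y z : K) : K :=
  x ^ 2 * y ^ 2 * z ^ 2 / ((1 - x) * (1 - y) * (1 - z))

def hookFun (x y z : K) : K :=
  x ^ 2 * y ^ 2 * z / ((1 - x) * (1 - y)) + x ^ 2 * y * z ^ 2 / ((1 - x) * (1 - z)) +
    x * y ^ 2 * z ^ 2 / ((1 - z) * (1 - y))

def degTwoFun (x y z : K) : K :=
  (2 * y * z / (1 - y - z) - 2 * y * z / ((1 - y) * (1 - z))) * (x ^ 2 / (1 - x)) +
  (2 * x * z / (1 - x - z) - 2 * x * z / ((1 - x) * (1 - z))) * (y ^ 2 / (1 - y)) +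
  (2 * x * y / (1 - x - y) - 2 * x * y / ((1 - x) * (1 - y))) * (z ^ 2 / (1 - z))

end RationalFunctions

/-- The field of fractions of `ℚ⟦x, y, z⟧`. It contains the ring of formal power series, so that
an identity between power series may be stated in it. -/
abbrev SeriesField : Type := FractionRing (MvPowerSeries (Fin 3) ℚ)

/-- The inclusion of the formal power series into their field of fractions. -/
noncomputable abbrev toSeriesField : MvPowerSeries (Fin 3) ℚ →+* SeriesField :=
  algebraMap (MvPowerSeries (Fin 3) ℚ) SeriesField

/-! Build a connected set cell by cell: each new cell enlarges the bounding box by at most one unit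
in one direction. An inscribed polyomino therefore has at least `∑ (n i - 1) + 1` cells, and the
union of the three edges at the corner attains this bound. When equality holds and the corner is a
cell, no growth step may be wasted. This makes the set a "corner tree": every cell is reached from
`0` by positive unit steps, and each boundary between consecutive layers is crossed exactly once
(`IsInscribed.isCornerTree`, with converse `IsCornerTree.card_le`).

Corner trees are sorted by the set of axes along which the corner has a neighbour. The empty set
gives a single cell. For `{i}`, deleting the corner leaves an arbitrary corner tree in the prism
shortened by one along `i`. Three axes force the union of the edges. Two axes in a flat prism force
the hook; in a prism with all sides at least two they give a planar corner tree with a row attached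
perpendicular to it (`treeCount_pair`). The resulting recurrence says that `1 - x - y - z` times the
total series equals `xyz + Tripod + Deg2 + 2Dhook`. Stairs are the corner trees containing the
opposite corner. Two corner directions are then impossible, so their recurrence keeps only the
source term `xyz`.

For `Deg2`, the planar tree must have exactly one corner direction, so its number is the planar
count minus the one hook. This difference satisfies a Pascal recurrence with constant source `2`,
whose series is the stated rational function by partial fractions. -/

/-! ### Growth of connected sets and the lower bound for the volume -/

/-- The unit step along the axis `i`. -/
abbrev unitStep (i : Fin 3) : Cell := Pi.single i 1

theorem exists_eq_add_unitStep_of_adj {u v : Cell} (h : cellGraph.Adj u v) :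
    ∃ i, v = u + unitStep i ∨ v = u - unitStep i := by
  have h' : |u 0 - v 0| + |u 1 - v 1| + |u 2 - v 2| = 1 := by
    have : ∑ i, |u i - v i| = 1 := h
    simpa [Fin.sum_univ_three] using this
  have key : (|u 0 - v 0| = 1 ∧ u 1 = v 1 ∧ u 2 = v 2) ∨ (|u 1 - v 1| = 1 ∧ u 0 = v 0 ∧ u 2 = v 2) ∨
      (|u 2 - v 2| = 1 ∧ u 0 = v 0 ∧ u 1 = v 1) := by
    rcases abs_cases (u 0 - v 0) with ⟨h0, h0'⟩ | ⟨h0, h0'⟩ <;>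
    rcases abs_cases (u 1 - v 1) with ⟨h1, h1'⟩ | ⟨h1, h1'⟩ <;>
    rcases abs_cases (u 2 - v 2) with ⟨h2, h2'⟩ | ⟨h2, h2'⟩ <;>
    omega
  rcases key with ⟨h0, h1, h2⟩ | ⟨h0, h1, h2⟩ | ⟨h0, h1, h2⟩
  · refine ⟨0, ?_⟩
    rcases (abs_eq one_pos.le).1 h0 with h0 | h0
    · right; ext l; fin_cases l <;> simp <;> omega
    · left; ext l; fin_cases l <;> simp <;> omega
  · refine ⟨1, ?_⟩
    rcases (abs_eq one_pos.le).1 h0 with h0 | h0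
    · right; ext l; fin_cases l <;> simp <;> omega
    · left; ext l; fin_cases l <;> simp <;> omega
  · refine ⟨2, ?_⟩
    rcases (abs_eq one_pos.le).1 h0 with h0 | h0
    · right; ext l; fin_cases l <;> simp <;> omega
    · left; ext l; fin_cases l <;> simp <;> omega

theorem adj_add_unitStep (u : Cell) (i : Fin 3) : cellGraph.Adj u (u + unitStep i) := by
  change ∑ l, |u l - (u + unitStep i) l| = 1
  fin_cases i <;> simp [Fin.sum_univ_three]

theorem unitStep_nonneg (i l : Fin 3) : 0 ≤ unitStep i l := by
  by_cases h : l = i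
  · subst h; simp
  · simp [h]

theorem IsPolyomino.exists_adj_notMem {S A : Finset Cell} (hS : IsPolyomino S) (hA : A ⊆ S)
    (hne : A.Nonempty) (hAS : A ≠ S) : ∃ a ∈ A, ∃ w ∈ S, w ∉ A ∧ cellGraph.Adj a w := by
  obtain ⟨a, ha⟩ := hne
  obtain ⟨b, hb, hbA⟩ := Finset.exists_of_ssubset (hA.ssubset_of_ne hAS)
  obtain ⟨p⟩ := hS.preconnected ⟨a, hA ha⟩ ⟨b, hb⟩
  obtain ⟨d, -, hd1, hd2⟩ := p.exists_boundary_dart {x | (x : Cell) ∈ A} ha hbA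
  exact ⟨_, hd1, _, d.snd.2, hd2, d.adj⟩

/-- Growth of a connected set by adjacent cells, along a property that can be kept. -/
theorem IsPolyomino.grow {S : Finset Cell} (hS : IsPolyomino S) (P : Finset Cell → Prop)
    (step : ∀ A, A ⊆ S → A.Nonempty → P A → ∀ a ∈ A, ∀ w ∈ S, w ∉ A → cellGraph.Adj a w →
      P (insert w A)) {A : Finset Cell} (hA : A ⊆ S) (hne : A.Nonempty) (hP : P A) : P S := by
  induction h : (S \ A).card generalizing A with
  | zero =>
    have : A = S := hA.antisymm (Finset.sdiff_eq_empty_iff_subset.1 (Finset.card_eq_zero.1 h))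
    exact this ▸ hP
  | succ m ih =>
    have hAS : A ≠ S := by rintro rfl; simp at h
    obtain ⟨a, ha, w, hw, hwA, hadj⟩ := hS.exists_adj_notMem hA hne hAS
    refine ih (A := insert w A) (Finset.insert_subset hw hA) (Finset.insert_nonempty _ _)
      (step A hA hne hP a ha w hw hwA hadj) ?_
    rw [Finset.card_sdiff_of_subset hA] at h
    rw [Finset.card_sdiff_of_subset (Finset.insert_subset hw hA), Finset.card_insert_of_notMem hwA]
    omega

/-- `A` lies in a box whose side lengths exceed one by at most `A.card - 1 - d` in total. -/
def InBoxOfDefect (d : ℤ) (A : Finset Cell) : Prop :=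
  ∃ lo hi : Cell, (∀ u ∈ A, lo ≤ u ∧ u ≤ hi) ∧ ∑ i, (hi i - lo i) + 1 + d ≤ A.card

/-- Moving one side of the box by one unit, in the direction of the step from `a` to `w`, is enough.
-/
theorem exists_box_insert {lo hi a w : Cell} (ha : lo ≤ a ∧ a ≤ hi) (h : cellGraph.Adj a w) :
    ∃ lo' hi' : Cell, lo' ≤ lo ∧ hi ≤ hi' ∧ (lo' ≤ w ∧ w ≤ hi') ∧
      ∑ i, (hi' i - lo' i) ≤ ∑ i, (hi i - lo i) + 1 := by
  obtain ⟨i, rfl | rfl⟩ := exists_eq_add_unitStep_of_adj h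
  · refine ⟨lo, hi + unitStep i, le_rfl, fun l => ?_, ⟨fun l => ?_, ?_⟩, ?_⟩
    · have := unitStep_nonneg i l
      simp only [Pi.add_apply]; omega
    · have := unitStep_nonneg i l
      have : lo l ≤ a l := ha.1 l
      simp only [Pi.add_apply]; omega
    · exact add_le_add_left ha.2 _
    · fin_cases i <;> simp [Fin.sum_univ_three] <;> omega
  · refine ⟨lo - unitStep i, hi, fun l => ?_, le_rfl, ⟨?_, fun l => ?_⟩, ?_⟩
    · have := unitStep_nonneg i l
      simp only [Pi.sub_apply]; omega
    · exact sub_le_sub_right ha.1 _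
    · have := unitStep_nonneg i l
      have : a l ≤ hi l := ha.2 l
      simp only [Pi.sub_apply]; omega
    · fin_cases i <;> simp [Fin.sum_univ_three]

theorem InBoxOfDefect.insert {d : ℤ} {A : Finset Cell} (h : InBoxOfDefect d A) {a w : Cell}
    (ha : a ∈ A) (hw : w ∉ A) (hadj : cellGraph.Adj a w) : InBoxOfDefect d (insert w A) := by
  obtain ⟨lo, hi, hA, hc⟩ := h
  obtain ⟨lo', hi', h1, h2, h3, h4⟩ := exists_box_insert (hA a ha) hadj
  refine ⟨lo', hi', ?_, ?_⟩
  · intro u hu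
    rcases Finset.mem_insert.1 hu with rfl | hu
    · exact h3
    · exact ⟨h1.trans (hA u hu).1, (hA u hu).2.trans h2⟩
  · rw [Finset.card_insert_of_notMem hw]; push_cast; omega

/-- A surplus of cells over side lengths is never lost: each further cell adds one to the volume and
at most one to the box. A wasted step in any part of `S` is thus paid for in the volume of `S`. -/
theorem InBoxOfDefect.of_subset {S A : Finset Cell} (hS : IsPolyomino S) {d : ℤ} (hA : A ⊆ S)
    (hne : A.Nonempty) (h : InBoxOfDefect d A) : InBoxOfDefect d S :=
  hS.grow (InBoxOfDefect d) (fun _ _ _ hP _ ha _ _ hwA hadj => hP.insert ha hwA hadj) hA hne h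

theorem IsInscribed.le_card_of_defect {n : Fin 3 → ℕ} {S : Finset Cell} (hS : IsInscribed n S)
    {d : ℤ} (h : InBoxOfDefect d S) : ∑ i, ((n i : ℤ) - 1) + 1 + d ≤ S.card := by
  obtain ⟨lo, hi, hb, hc⟩ := h
  have : ∑ i, ((n i : ℤ) - 1) ≤ ∑ i, (hi i - lo i) := by
    refine Finset.sum_le_sum fun i _ => ?_
    obtain ⟨⟨u, hu, hu0⟩, v, hv, hv1⟩ := hS.2.2 i
    have : lo i ≤ u i := (hb u hu).1 i
    have : v i ≤ hi i := (hb v hv).2 i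
    omega
  omega

theorem inBoxOfDefect_singleton (u : Cell) : InBoxOfDefect 0 {u} :=
  ⟨u, u, by simp, by simp⟩

theorem IsInscribed.le_card {n : Fin 3 → ℕ} {S : Finset Cell} (hS : IsInscribed n S) :
    ∑ i, ((n i : ℤ) - 1) + 1 ≤ S.card := by
  obtain ⟨⟨u, hu⟩⟩ := hS.1.nonempty
  have := hS.le_card_of_defect ((inBoxOfDefect_singleton u).of_subset hS.1
    (Finset.singleton_subset_iff.2 hu) (Finset.singleton_nonempty u))
  omega

/-! ### Corner trees as the extremal sets -/

/-- The sets of cells in the prism of size `n` grown from the corner `0` by positive unit steps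
such that each layer boundary of the prism is crossed once. -/
structure IsCornerTree (n : Fin 3 → ℕ) (S : Finset Cell) : Prop where
  zero_mem : 0 ∈ S
  inPrism : ∀ u ∈ S, InPrism n u
  far : ∀ i, ∃ u ∈ S, u i = (n i : ℤ) - 1
  pred : ∀ u ∈ S, u ≠ 0 → ∃ i, u - unitStep i ∈ S
  gap : ∀ i, ∀ u ∈ S, ∀ v ∈ S, u - unitStep i ∈ S → v - unitStep i ∈ S → u i = v i → u = v

/-- By the bound on the volume, no part of `S` has defect one. A growth step that adds a cell
without enlarging the box would create such a part. A negative step does this for `pred`, and a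
second crossing of the same layer boundary does it for `gap`. -/
theorem IsInscribed.isCornerTree {n : Fin 3 → ℕ} {S : Finset Cell} (hS : IsInscribed n S)
    (h0 : (0 : Cell) ∈ S) (hc : (S.card : ℤ) ≤ ∑ i, ((n i : ℤ) - 1) + 1) : IsCornerTree n S := by
  have hno : ∀ A, A ⊆ S → A.Nonempty → ¬ InBoxOfDefect 1 A := fun A hA hne h => by
    have := hS.le_card_of_defect (h.of_subset hS.1 hA hne)
    omega
  refine ⟨h0, hS.2.1, fun i => (hS.2.2 i).2, ?_, ?_⟩
  -- The box is kept with its lower corner at `0`. A step in a negative direction stays inside the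
  -- prism, hence inside this box, and is excluded.
  · have key := hS.1.grow (A := {0}) (P := fun A => (∃ hi : Cell, (∀ u ∈ A, u ≤ hi) ∧
        ∑ i, hi i + 1 ≤ A.card) ∧ ∀ u ∈ A, u ≠ 0 → ∃ i, u - unitStep i ∈ A) ?_ (by simpa using h0)
        (by simp) ⟨⟨0, by simp, by simp⟩, by simp⟩
    · exact key.2
    rintro A hA hne ⟨⟨hi, hb, hcard⟩, hp⟩ a ha w hw hwA hadj
    have hci : (insert w A).card = A.card + 1 := Finset.card_insert_of_notMem hwA
    obtain ⟨i, rfl | rfl⟩ := exists_eq_add_unitStep_of_adj hadj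
    · refine ⟨⟨hi + unitStep i, ?_, ?_⟩, ?_⟩
      · intro u hu l
        have h1 := unitStep_nonneg i l
        rcases Finset.mem_insert.1 hu with rfl | hu
        · have : a l ≤ hi l := hb a ha l
          simp only [Pi.add_apply]; omega
        · have : u l ≤ hi l := hb u hu l
          simp only [Pi.add_apply]; omega
      · have : ∑ l, (hi + unitStep i) l = ∑ l, hi l + 1 := by
          simp [Finset.sum_add_distrib]
        rw [this, hci]; push_cast; omega
      · intro u hu hu0
        rcases Finset.mem_insert.1 hu with rfl | hu
        · exact ⟨i, by simp [ha]⟩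
        · obtain ⟨l, hl⟩ := hp u hu hu0
          exact ⟨l, Finset.mem_insert_of_mem hl⟩
    · exfalso
      refine hno _ (Finset.insert_subset hw hA) (Finset.insert_nonempty _ _)
        ⟨0, hi, ?_, ?_⟩
      · intro u hu
        refine ⟨fun l => (hS.2.1 u (Finset.insert_subset hw hA hu) l).1, fun l => ?_⟩
        rcases Finset.mem_insert.1 hu with rfl | hu
        · have := unitStep_nonneg i l
          have : a l ≤ hi l := hb a ha l
          simp only [Pi.sub_apply]; omega
        · exact hb u hu l
      · rw [hci]; push_cast; simp only [Pi.zero_apply, sub_zero]; omega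
  · intro i u hu v hv hu' hv' huv
    by_contra hne
    have hadj0 : cellGraph.Adj (u - unitStep i) u := by
      simpa using adj_add_unitStep (u - unitStep i) i
    have hnm : u ∉ ({u - unitStep i} : Finset Cell) := by
      simpa using hadj0.ne.symm
    -- Growth starts from the first crossing and tracks that the second one is never completed. At
    -- the end the set is `S`, which contains both.
    have key := hS.1.grow (A := {u, u - unitStep i}) (P := fun A => u ∈ A ∧ u - unitStep i ∈ A ∧
      InBoxOfDefect 0 A ∧ ¬ (v ∈ A ∧ v - unitStep i ∈ A)) ?_
      (by intro x hx; simp only [Finset.mem_insert, Finset.mem_singleton] at hx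
          rcases hx with rfl | rfl <;> assumption) (by simp)
      ⟨by simp, by simp, (inBoxOfDefect_singleton _).insert (by simp) hnm hadj0, ?_⟩
    · exact key.2.2.2 ⟨hv, hv'⟩
    · rintro A hA hAne ⟨h1, h2, h3, h4⟩ a ha w hw hwA hadj
      refine ⟨Finset.mem_insert_of_mem h1, Finset.mem_insert_of_mem h2, h3.insert ha hwA hadj, ?_⟩
      rintro ⟨hva, hva'⟩
      obtain ⟨lo, hi, hb, hcard⟩ := h3
      -- The old box already contains the cell completing the second crossing: its coordinate along
      -- `i` is that of `u` or of `u - unitStep i`, and its other coordinates are those of the end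
      -- of the second crossing already present.
      refine hno _ (Finset.insert_subset hw hA) (Finset.insert_nonempty _ _) ⟨lo, hi, ?_, ?_⟩
      · intro x hx
        rcases Finset.mem_insert.1 hx with rfl | hx
        swap
        · exact hb x hx
        have e1 := hb _ h1
        have e2 := hb _ h2
        rcases Finset.mem_insert.1 hva with rfl | hvA
        · have hvA' : v - unitStep i ∈ A := by
            rcases Finset.mem_insert.1 hva' with h | h
            · have := congrFun h i; simp at this
            · exact h
          have e3 := hb _ hvA'
          constructor
          · intro l
            by_cases hl : l = i
            · subst hl; rw [← huv]; exact e1.1 l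
            · simpa [hl] using e3.1 l
          · intro l
            by_cases hl : l = i
            · subst hl; rw [← huv]; exact e1.2 l
            · simpa [hl] using e3.2 l
        · have e3 := hb _ hvA
          rcases Finset.mem_insert.1 hva' with rfl | h
          · constructor
            · intro l
              by_cases hl : l = i
              · subst hl; simpa [huv] using e2.1 l
              · simpa [hl] using e3.1 l
            · intro l
              by_cases hl : l = i
              · subst hl; simpa [huv] using e2.2 l
              · simpa [hl] using e3.2 l
          · exact absurd ⟨hvA, h⟩ h4
      · rw [Finset.card_insert_of_notMem hwA]; push_cast; omega
    · simp only [Finset.mem_insert, Finset.mem_singleton]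
      rintro ⟨h | h, -⟩
      · exact hne h.symm
      · have := congrFun h i
        simp only [Pi.sub_apply, Pi.single_eq_same] at this
        omega

namespace IsCornerTree

variable {n : Fin 3 → ℕ} {S : Finset Cell}

theorem nonneg (h : IsCornerTree n S) {u : Cell} (hu : u ∈ S) (i : Fin 3) : 0 ≤ u i :=
  (h.inPrism u hu i).1

theorem one_le (h : IsCornerTree n S) (i : Fin 3) : 1 ≤ n i := by
  have := (h.inPrism 0 h.zero_mem i).2
  simp at this; omega

/-- Induction from the corner along the steps of a corner tree. -/
theorem induction (h : IsCornerTree n S) {P : Cell → Prop} (zero : P 0)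
    (step : ∀ u ∈ S, ∀ i, u - unitStep i ∈ S → P (u - unitStep i) → P u) : ∀ u ∈ S, P u := by
  intro u hu
  induction hm : (∑ i, u i).toNat generalizing u with
  | zero =>
    have h0 : u = 0 := by
      ext i
      have h1 : ∀ i ∈ Finset.univ, 0 ≤ u i := fun i _ => h.nonneg hu i
      exact (Finset.sum_eq_zero_iff_of_nonneg h1).1
        (le_antisymm (Int.toNat_eq_zero.1 hm) (Finset.sum_nonneg h1)) i (Finset.mem_univ i)
    rwa [h0]
  | succ m ih =>
    have h0 : u ≠ 0 := by rintro rfl; simp at hm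
    obtain ⟨i, hi⟩ := h.pred u hu h0
    refine step u hu i hi (ih _ hi ?_)
    have : ∑ l, (u - unitStep i) l = ∑ l, u l - 1 := by simp [Finset.sum_sub_distrib]
    omega

theorem one_le_apply (h : IsCornerTree n S) {u : Cell} {i : Fin 3} (hu : u - unitStep i ∈ S) :
    1 ≤ u i := by
  have := h.nonneg hu i
  simp at this; omega

theorem isPolyomino (h : IsCornerTree n S) : IsPolyomino S := by
  have key : ∀ u ∈ S, ∀ hu : u ∈ S,
      (cellGraph.induce (S : Set Cell)).Reachable ⟨0, h.zero_mem⟩ ⟨u, hu⟩ := by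
    refine h.induction (fun _ => SimpleGraph.Reachable.refl _) ?_
    intro u hu i hi ih _
    refine (ih hi).trans (SimpleGraph.Adj.reachable ?_)
    have := adj_add_unitStep (u - unitStep i) i
    simpa using this
  exact (SimpleGraph.connected_iff_exists_forall_reachable _).2
    ⟨⟨0, h.zero_mem⟩, fun ⟨u, hu⟩ => key u hu hu⟩

theorem isInscribed (h : IsCornerTree n S) : IsInscribed n S :=
  ⟨h.isPolyomino, h.inPrism, fun i => ⟨⟨0, h.zero_mem, rfl⟩, h.far i⟩⟩

/-- Send each cell other than the corner to the layer boundary crossed by a chosen step into it. By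
`gap` this is injective, and there are `∑ (n i - 1)` layer boundaries. -/
theorem card_le (h : IsCornerTree n S) : (S.card : ℤ) ≤ ∑ i, ((n i : ℤ) - 1) + 1 := by
  classical
  have hp : ∀ u : Cell, ∃ i, u ∈ S → u ≠ 0 → u - unitStep i ∈ S := by
    intro u
    by_cases hu : u ∈ S ∧ u ≠ 0
    · obtain ⟨i, hi⟩ := h.pred u hu.1 hu.2
      exact ⟨i, fun _ _ => hi⟩
    · exact ⟨0, fun h1 h2 => absurd ⟨h1, h2⟩ hu⟩
  choose f hf using hp
  have hle : (S.erase 0).card ≤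
      (Finset.univ.sigma fun i : Fin 3 => Finset.Ico (1 : ℤ) (n i)).card := by
    refine Finset.card_le_card_of_injOn (fun u => ⟨f u, u (f u)⟩) ?_ ?_
    · intro u hu
      obtain ⟨hu0, hu⟩ := Finset.mem_erase.1 hu
      simp only [Finset.coe_sigma, Set.mem_sigma_iff, Finset.coe_univ, Set.mem_univ, true_and,
        Finset.coe_Ico, Set.mem_Ico]
      exact ⟨h.one_le_apply (hf u hu hu0), (h.inPrism u hu _).2⟩
    · intro u hu v hv huv
      obtain ⟨hu0, hu⟩ := Finset.mem_erase.1 hu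
      obtain ⟨hv0, hv⟩ := Finset.mem_erase.1 hv
      simp only [Sigma.mk.injEq] at huv
      obtain ⟨h1, h2⟩ := huv
      have h3 := hf v hv hv0
      rw [← h1] at h3
      refine h.gap (f u) u hu v hv (hf u hu hu0) h3 ?_
      rw [h1] at h2 ⊢
      exact eq_of_heq h2
  rw [Finset.card_sigma, Finset.card_erase_of_mem h.zero_mem] at hle
  simp only [Int.card_Ico, Fin.sum_univ_three] at hle ⊢
  have h0 := h.one_le 0
  have h1 := h.one_le 1
  have h2 := h.one_le 2
  omega

theorem isMinimalInscribed (h : IsCornerTree n S) : IsMinimalInscribed n S :=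
  ⟨h.isInscribed, fun T hT => by have := hT.le_card; have := h.card_le; omega⟩

theorem isCornerPolyomino (h : IsCornerTree n S) : IsCornerPolyomino n S :=
  ⟨h.isMinimalInscribed, h.zero_mem⟩

end IsCornerTree

/-! ### The minimal volume is attained: corner-polyominoes are the corner trees -/

theorem finite_setOf_inPrism (n : Fin 3 → ℕ) : {u : Cell | InPrism n u}.Finite := by
  refine (Set.finite_Icc (0 : Cell) (fun i => (n i : ℤ))).subset ?_
  intro u hu
  exact ⟨fun i => (hu i).1, fun i => (hu i).2.le⟩

open Classical in
/-- The cells of the prism on the three edges through the corner `0`. -/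
noncomputable def axesSet (n : Fin 3 → ℕ) : Finset Cell :=
  (finite_setOf_inPrism n).toFinset.filter fun u => ∃ i, ∀ l, l ≠ i → u l = 0

theorem mem_axesSet {n : Fin 3 → ℕ} {u : Cell} :
    u ∈ axesSet n ↔ InPrism n u ∧ ∃ i, ∀ l, l ≠ i → u l = 0 := by
  simp [axesSet]

/-- This witness of the minimal volume exists in every prism, so a minimal inscribed set can be
compared with it. -/
theorem isCornerTree_axesSet {n : Fin 3 → ℕ} (hn : ∀ i, 1 ≤ n i) : IsCornerTree n (axesSet n) where
  zero_mem := mem_axesSet.2 ⟨fun i => ⟨le_rfl, by have := hn i; simp; omega⟩, 0, by simp⟩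
  inPrism u hu := (mem_axesSet.1 hu).1
  far i := by
    refine ⟨Pi.single i ((n i : ℤ) - 1), mem_axesSet.2 ⟨fun l => ?_, i, ?_⟩, by simp⟩
    · have := hn l
      by_cases hl : l = i
      · subst hl; simp; omega
      · simp [hl]; omega
    · intro l hl; simp [hl]
  pred u hu hu0 := by
    obtain ⟨hu, i, hi⟩ := mem_axesSet.1 hu
    have hui : u i ≠ 0 := fun h => hu0 (by ext l; by_cases hl : l = i <;> simp_all)
    refine ⟨i, mem_axesSet.2 ⟨fun l => ?_, i, fun l hl => by simp [hl, hi l hl]⟩⟩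
    have := hu l
    by_cases hl : l = i
    · subst hl; simp; omega
    · simpa [hl] using this
  gap i u hu v hv hu' hv' huv := by
    have key : ∀ w ∈ axesSet n, w - unitStep i ∈ axesSet n → ∀ l, l ≠ i → w l = 0 := by
      intro w hw hw'
      obtain ⟨hw, j, hj⟩ := mem_axesSet.1 hw
      have h1 := ((mem_axesSet.1 hw').1 i).1
      by_cases hij : i = j
      · subst hij; exact hj
      · have := hj i hij
        simp [this] at h1
    ext l
    by_cases hl : l = i
    · rw [hl, huv]
    · rw [key u hu hu' l hl, key v hv hv' l hl]

theorem IsMinimalInscribed.isCornerTree {n : Fin 3 → ℕ} {S : Finset Cell}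
    (h : IsMinimalInscribed n S) (h0 : (0 : Cell) ∈ S) : IsCornerTree n S := by
  refine h.1.isCornerTree h0 ?_
  have hn : ∀ i, 1 ≤ n i := fun i => by
    have := (h.1.2.1 0 h0 i).2
    simp at this; omega
  have h1 := h.2 _ (isCornerTree_axesSet hn).isInscribed
  have h2 := (isCornerTree_axesSet hn).card_le
  omega

theorem isCornerPolyomino_iff {n : Fin 3 → ℕ} {S : Finset Cell} :
    IsCornerPolyomino n S ↔ IsCornerTree n S :=
  ⟨fun h => h.1.isCornerTree h.2, fun h => h.isCornerPolyomino⟩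

/-! ### Corner directions -/

/-- The axes along which the corner `0` has a neighbour in `S`. -/
def cornerDirs (S : Finset Cell) : Finset (Fin 3) :=
  Finset.univ.filter fun i => unitStep i ∈ S

theorem mem_cornerDirs {S : Finset Cell} {i : Fin 3} : i ∈ cornerDirs S ↔ unitStep i ∈ S := by
  simp [cornerDirs]

namespace IsCornerTree

variable {n : Fin 3 → ℕ} {S T : Finset Cell}

/-- Both sets have the minimal volume, so inclusion forces equality. -/
theorem eq_of_subset (hS : IsCornerTree n S) (hT : IsCornerTree n T) (h : S ⊆ T) : S = T :=
  Finset.eq_of_subset_of_card_le h (hT.isMinimalInscribed.2 S hS.isInscribed)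

/-- A path of positive steps from the corner to `u` begins along a corner direction, and coordinates
never decrease afterwards. -/
theorem exists_mem_cornerDirs (h : IsCornerTree n S) {u : Cell} (hu : u ∈ S) (hu0 : u ≠ 0) :
    ∃ i ∈ cornerDirs S, 1 ≤ u i := by
  have key : ∀ u ∈ S, u ≠ 0 → ∃ i ∈ cornerDirs S, 1 ≤ u i := by
    refine h.induction (by simp) ?_
    intro u hu i hi ih _
    by_cases h0 : u - unitStep i = 0
    · have hui : u = unitStep i := sub_eq_zero.1 h0
      exact ⟨i, mem_cornerDirs.2 (hui ▸ hu), by simp [hui]⟩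
    · obtain ⟨l, hl, hl1⟩ := ih h0
      have := unitStep_nonneg i l
      refine ⟨l, hl, ?_⟩
      simp only [Pi.sub_apply] at hl1; omega
  exact key u hu hu0

theorem two_le (h : IsCornerTree n S) {i : Fin 3} (hi : i ∈ cornerDirs S) : 2 ≤ n i := by
  have := (h.inPrism _ (mem_cornerDirs.1 hi) i).2
  simp at this; omega

/-- The step from `0` to `unitStep i` is the only crossing from layer `0` to layer `1` along `i`. A
cell with positive coordinate `j` therefore cannot leave the face `u i = 0`, and symmetrically. -/
theorem eq_zero_or_eq_zero (h : IsCornerTree n S) {i j : Fin 3} (hi : i ∈ cornerDirs S)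
    (hj : j ∈ cornerDirs S) (hij : i ≠ j) : ∀ u ∈ S, u i = 0 ∨ u j = 0 := by
  have key : ∀ i j : Fin 3, i ∈ cornerDirs S → i ≠ j → ∀ u ∈ S, u - unitStep i ∈ S →
      (u - unitStep i) i = 0 → u j = 0 := by
    intro i j hi hij u hu hui h0
    have := h.gap i u hu (unitStep i) (mem_cornerDirs.1 hi) hui (by simpa using h.zero_mem)
      (by simp at h0 ⊢; omega)
    rw [this]; simp [hij.symm]
  refine h.induction (by simp) ?_
  intro u hu l hl ih
  rcases ih with h0 | h0
  · by_cases hli : i = l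
    · subst hli
      exact Or.inr (key i j hi hij u hu hl h0)
    · left; simpa [hli] using h0
  · by_cases hlj : j = l
    · subst hlj
      exact Or.inl (key j i hj hij.symm u hu hl h0)
    · right; simpa [hlj] using h0

/-- The step by which the path from the corner to `u` leaves the face `u i = 0`. -/
theorem exists_first_step (h : IsCornerTree n S) (i : Fin 3) :
    ∀ u ∈ S, 1 ≤ u i → ∃ w ∈ S, w - unitStep i ∈ S ∧ w i = 1 ∧ w ≤ u := by
  refine h.induction (by simp) ?_
  intro u hu l hl ih hui
  by_cases h1 : 1 ≤ (u - unitStep l) i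
  · obtain ⟨w, hw, hw', hwi, hwu⟩ := ih h1
    refine ⟨w, hw, hw', hwi, hwu.trans fun m => ?_⟩
    have := unitStep_nonneg l m
    simp only [Pi.sub_apply]; omega
  · have hil : i = l := by
      by_contra hil
      simp [hil] at h1; omega
    subst hil
    exact ⟨u, hu, hl, by simp at h1; omega, le_rfl⟩

theorem cellDegree_zero (h : IsCornerTree n S) : cellDegree S 0 = (cornerDirs S).card := by
  have : {v : Cell | v ∈ S ∧ cellGraph.Adj 0 v} =
      ((cornerDirs S).image (fun i => unitStep i) : Finset Cell) := by
    ext v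
    simp only [Set.mem_ofPred_eq, Finset.coe_image, Set.mem_image, Finset.mem_coe, mem_cornerDirs]
    constructor
    · rintro ⟨hv, hadj⟩
      obtain ⟨i, rfl | rfl⟩ := exists_eq_add_unitStep_of_adj hadj
      · exact ⟨i, by simpa using hv, by simp⟩
      · have := h.nonneg hv i
        simp at this
    · rintro ⟨i, hi, rfl⟩
      exact ⟨hi, by simpa using adj_add_unitStep 0 i⟩
  rw [cellDegree, this, Set.ncard_coe_finset, Finset.card_image_of_injective]
  intro i j hij
  by_contra hne
  have := congrFun hij i
  simp [hne] at this

theorem eq_axesSet (h : IsCornerTree n S) (hs : ∀ u ∈ S, ∃ i, ∀ l, l ≠ i → u l = 0) :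
    S = axesSet n :=
  h.eq_of_subset (isCornerTree_axesSet h.one_le) fun u hu =>
    mem_axesSet.2 ⟨h.inPrism u hu, hs u hu⟩

end IsCornerTree

theorem cornerDirs_axesSet {n : Fin 3 → ℕ} (hn : ∀ i, 1 ≤ n i) :
    cornerDirs (axesSet n) = Finset.univ.filter fun i => 2 ≤ n i := by
  ext i
  simp only [mem_cornerDirs, mem_axesSet, Finset.mem_filter, Finset.mem_univ, true_and]
  constructor
  · rintro ⟨h, -⟩
    have := (h i).2
    simp at this; omega
  · intro h
    refine ⟨fun l => ⟨unitStep_nonneg i l, ?_⟩, i, fun l hl => by simp [hl]⟩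
    by_cases hl : l = i
    · subst hl; simp; omega
    · have := hn l
      simp [hl]; omega

/-! ### One corner direction: removing the corner cell -/

/-- Translation of `S` by a unit step, with a new corner cell. -/
def prependStep (i : Fin 3) (S : Finset Cell) : Finset Cell :=
  insert 0 (S.image (· + unitStep i))

theorem mem_prependStep {i : Fin 3} {S : Finset Cell} {u : Cell} :
    u ∈ prependStep i S ↔ u = 0 ∨ u - unitStep i ∈ S := by
  simp only [prependStep, Finset.mem_insert, Finset.mem_image]
  refine or_congr_right ⟨?_, fun h => ⟨_, h, by simp⟩⟩
  rintro ⟨a, ha, rfl⟩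
  simpa using ha

theorem IsCornerTree.prependStep {n : Fin 3 → ℕ} {S : Finset Cell} (h : IsCornerTree n S)
    (i : Fin 3) : IsCornerTree (n + Pi.single i 1) (prependStep i S) where
  zero_mem := mem_prependStep.2 (Or.inl rfl)
  inPrism u hu l := by
    rcases mem_prependStep.1 hu with rfl | hu
    · have := h.one_le l
      simp; omega
    · have := h.inPrism _ hu l
      by_cases hl : l = i
      · subst hl; simp at this ⊢; omega
      · simpa [hl] using this
  far l := by
    obtain ⟨u, hu, hul⟩ := h.far l
    refine ⟨u + unitStep i, mem_prependStep.2 (Or.inr (by simpa using hu)), ?_⟩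
    by_cases hl : l = i
    · subst hl; simp; omega
    · simpa [hl] using hul
  pred u hu hu0 := by
    rcases mem_prependStep.1 hu with hu | hu
    · exact absurd hu hu0
    by_cases h0 : u - unitStep i = 0
    · exact ⟨i, mem_prependStep.2 (Or.inl h0)⟩
    · obtain ⟨l, hl⟩ := h.pred _ hu h0
      exact ⟨l, mem_prependStep.2 (Or.inr (by rwa [sub_right_comm]))⟩
  gap l u hu v hv hu' hv' huv := by
    -- Every step in the new set is either the initial one from `0` to `unitStep i` or the translate
    -- of a step in `S`. The initial one crosses a boundary below the translate of `S`.
    have key : ∀ w ∈ _root_.prependStep i S, w - unitStep l ∈ _root_.prependStep i S →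
        w - unitStep i ∈ S ∧ ((l = i ∧ w = unitStep i) ∨ w - unitStep i - unitStep l ∈ S) := by
      intro w hw hw'
      rcases mem_prependStep.1 hw with rfl | hw
      · rcases mem_prependStep.1 hw' with h1 | h1
        · have := congrFun h1 l
          simp at this
        · have h2 := h.nonneg h1 l
          have := unitStep_nonneg i l
          simp at h2; omega
      refine ⟨hw, ?_⟩
      rcases mem_prependStep.1 hw' with h1 | h1
      · left
        have hwl : w = unitStep l := sub_eq_zero.1 h1
        have h2 := h.nonneg hw i
        have hli : l = i := by
          by_contra hli
          rw [hwl] at h2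
          simp [Ne.symm hli] at h2
        exact ⟨hli, hli ▸ hwl⟩
      · right; rwa [sub_right_comm]
    obtain ⟨hu1, hu2⟩ := key u hu hu'
    obtain ⟨hv1, hv2⟩ := key v hv hv'
    rcases hu2 with ⟨hl, hu2⟩ | hu2 <;> rcases hv2 with ⟨hl', hv2⟩ | hv2
    · rw [hu2, hv2]
    · subst hl
      have := h.nonneg hv2 l
      rw [hu2] at huv
      simp at huv this; omega
    · subst hl'
      have := h.nonneg hu2 l
      rw [hv2] at huv
      simp at huv this; omega
    · have := h.gap l _ hu1 _ hv1 hu2 hv2 (by simp [huv])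
      exact sub_left_injective this

theorem IsCornerTree.cornerDirs_prependStep {n : Fin 3 → ℕ} {S : Finset Cell}
    (h : IsCornerTree n S) (i : Fin 3) : cornerDirs (_root_.prependStep i S) = {i} := by
  ext l
  rw [mem_cornerDirs, mem_prependStep, Finset.mem_singleton]
  constructor
  · rintro (h0 | h0)
    · have := congrFun h0 l
      simp at this
    · have := h.nonneg h0 i
      by_contra hli
      simp [Ne.symm hli] at this
  · rintro rfl
    exact Or.inr (by simpa using h.zero_mem)

theorem prependStep_injOn (n : Fin 3 → ℕ) (i : Fin 3) :
    Set.InjOn (prependStep i) {S | IsCornerTree n S} := by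
  have key : ∀ S T, IsCornerTree n S → prependStep i S = prependStep i T → S ⊆ T := by
    intro S T hS hST u hu
    have h1 : u + unitStep i ∈ prependStep i S := mem_prependStep.2 (Or.inr (by simpa using hu))
    rw [hST] at h1
    rcases mem_prependStep.1 h1 with h1 | h1
    · have h2 := hS.nonneg hu i
      have := congrFun h1 i
      simp at this; omega
    · simpa using h1
  exact fun S hS T hT hST => (key S T hS hST).antisymm (key T S hT hST.symm)

/-- If `i` is the only corner direction, all cells except the corner have positive coordinate `i`,
so the rest can be translated back by one step. -/
theorem IsCornerTree.exists_prependStep {n : Fin 3 → ℕ} {i : Fin 3} {S : Finset Cell}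
    (h : IsCornerTree (n + Pi.single i 1) S) (hd : cornerDirs S = {i}) :
    ∃ T, IsCornerTree n T ∧ _root_.prependStep i T = S := by
  have hpos : ∀ u ∈ S, u ≠ 0 → 1 ≤ u i := fun u hu hu0 => by
    obtain ⟨l, hl, hl1⟩ := h.exists_mem_cornerDirs hu hu0
    rw [hd, Finset.mem_singleton] at hl
    exact hl ▸ hl1
  have hi : unitStep i ∈ S := mem_cornerDirs.1 (by simp [hd])
  have hmem : ∀ u, u ∈ (S.erase 0).image (· - unitStep i) ↔ u + unitStep i ∈ S ∧ 0 ≤ u i := by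
    intro u
    simp only [Finset.mem_image, Finset.mem_erase]
    constructor
    · rintro ⟨v, ⟨hv0, hv⟩, rfl⟩
      have := hpos v hv hv0
      exact ⟨by simpa using hv, by simp; omega⟩
    · rintro ⟨h1, h2⟩
      refine ⟨_, ⟨fun h0 => ?_, h1⟩, by simp⟩
      have := congrFun h0 i
      simp at this; omega
  refine ⟨(S.erase 0).image (· - unitStep i), ⟨?_, ?_, ?_, ?_, ?_⟩, ?_⟩
  · exact (hmem 0).2 ⟨by simpa using hi, le_rfl⟩
  · intro u hu l
    obtain ⟨h1, h2⟩ := (hmem u).1 hu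
    have := h.inPrism _ h1 l
    by_cases hl : l = i
    · subst hl; simp at this; omega
    · simpa [hl] using this
  · intro l
    by_cases hl : ∃ u ∈ S, u ≠ 0 ∧ u l = ((n + Pi.single i 1 : Fin 3 → ℕ) l : ℤ) - 1
    · obtain ⟨u, hu, hu0, hul⟩ := hl
      have := hpos u hu hu0
      refine ⟨u - unitStep i, (hmem _).2 ⟨by simpa using hu, by simp; omega⟩, ?_⟩
      by_cases hl : l = i
      · subst hl; simp at hul ⊢; omega
      · simpa [hl] using hul
    -- Only the corner reaches the last layer along `l`. That side then has length one, so `l ≠ i`,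
    -- and the new corner also lies in the last layer.
    · obtain ⟨u, hu, hul⟩ := h.far l
      have hu0 : u = 0 := by by_contra hu0; exact hl ⟨u, hu, hu0, hul⟩
      refine ⟨0, (hmem 0).2 ⟨by simpa using hi, le_rfl⟩, ?_⟩
      have hli : l ≠ i := by
        rintro rfl
        have := h.two_le (i := l) (by simp [hd])
        rw [hu0] at hul
        simp at hul this; omega
      rw [hu0] at hul
      simpa [hli] using hul
  · intro u hu hu0
    obtain ⟨h1, h2⟩ := (hmem u).1 hu
    obtain ⟨l, hl⟩ := h.pred _ h1 (fun h0 => by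
      have := congrFun h0 i
      simp at this; omega)
    refine ⟨l, (hmem _).2 ⟨by rwa [← add_sub_right_comm], ?_⟩⟩
    by_cases h0 : u + unitStep i - unitStep l = 0
    · exfalso
      have hl : u + unitStep i = unitStep l := sub_eq_zero.1 h0
      have : l ∈ cornerDirs S := mem_cornerDirs.2 (hl ▸ h1)
      rw [hd, Finset.mem_singleton] at this
      subst this
      exact hu0 (by simpa using hl)
    · have := hpos _ hl h0
      simp at this ⊢; omega
  · intro l u hu v hv hu' hv' huv
    have := h.gap l _ ((hmem _).1 hu).1 _ ((hmem _).1 hv).1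
      (by rw [add_sub_right_comm]; exact ((hmem _).1 hu').1)
      (by rw [add_sub_right_comm]; exact ((hmem _).1 hv').1) (by simp [huv])
    exact add_left_injective _ this
  · ext u
    rw [mem_prependStep, hmem]
    constructor
    · rintro (rfl | ⟨h1, -⟩)
      · exact h.zero_mem
      · simpa using h1
    · intro hu
      by_cases hu0 : u = 0
      · exact Or.inl hu0
      · have := hpos u hu hu0
        exact Or.inr ⟨by simpa using hu, by simp; omega⟩

/-! ### Counting corner trees by their corner directions -/

/-- The number of corner trees in the prism of size `n` with property `Q`. -/
noncomputable def treeCount (Q : Finset Cell → Prop) (n : Fin 3 → ℕ) : ℕ :=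
  {S | IsCornerTree n S ∧ Q S}.ncard

theorem finite_isCornerTree (n : Fin 3 → ℕ) (Q : Finset Cell → Prop) :
    {S | IsCornerTree n S ∧ Q S}.Finite :=
  (finite_inPrism n).subset fun _ hS => hS.1.inPrism

theorem treeCount_eq_zero {Q : Finset Cell → Prop} {n : Fin 3 → ℕ}
    (h : ∀ S, IsCornerTree n S → ¬ Q S) : treeCount Q n = 0 := by
  have : {S | IsCornerTree n S ∧ Q S} = ∅ :=
    Set.eq_empty_of_forall_notMem fun S hS => h S hS.1 hS.2
  rw [treeCount, this, Set.ncard_empty]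

theorem treeCount_eq_sum (Q : Finset Cell → Prop) (n : Fin 3 → ℕ) :
    treeCount Q n = ∑ D : Finset (Fin 3), treeCount (fun S => Q S ∧ cornerDirs S = D) n := by
  classical
  have hf := finite_isCornerTree n Q
  rw [treeCount, Set.ncard_eq_toFinset_card _ hf,
    Finset.card_eq_sum_card_fiberwise (f := cornerDirs) (t := Finset.univ) (by simp)]
  refine Finset.sum_congr rfl fun D _ => ?_
  rw [treeCount, ← Set.ncard_coe_finset]
  congr 1
  ext S
  simp [and_assoc]

theorem treeCount_singleton {Q Q' : Finset Cell → Prop} {n : Fin 3 → ℕ} {i : Fin 3}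
    (hQ : ∀ S, IsCornerTree n S → (Q (prependStep i S) ↔ Q' S)) :
    treeCount (fun S => Q S ∧ cornerDirs S = {i}) (n + Pi.single i 1) = treeCount Q' n := by
  rw [treeCount, treeCount, ← Set.InjOn.ncard_image (s := {S | IsCornerTree n S ∧ Q' S})
    (f := prependStep i) ((prependStep_injOn n i).mono fun S hS => hS.1)]
  congr 1
  ext S
  simp only [Set.mem_ofPred_eq, Set.mem_image]
  constructor
  · rintro ⟨h, hq, hd⟩
    obtain ⟨T, hT, rfl⟩ := h.exists_prependStep hd
    exact ⟨T, ⟨hT, (hQ T hT).1 hq⟩, rfl⟩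
  · rintro ⟨T, ⟨hT, hq⟩, rfl⟩
    exact ⟨hT.prependStep i, (hQ T hT).2 hq, hT.cornerDirs_prependStep i⟩

theorem treeCount_axesSet {Q : Finset Cell → Prop} {n : Fin 3 → ℕ} (hn : ∀ i, 1 ≤ n i)
    (h : ∀ S, IsCornerTree n S → (Q S ↔ S = axesSet n)) : treeCount Q n = 1 := by
  rw [treeCount, Set.ncard_eq_one]
  refine ⟨axesSet n, Set.eq_singleton_iff_unique_mem.2 ⟨?_, fun S hS => (h S hS.1).1 hS.2⟩⟩
  exact ⟨isCornerTree_axesSet hn, (h _ (isCornerTree_axesSet hn)).2 rfl⟩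

/-! ### Two corner directions: a planar corner tree and a perpendicular row -/

/-- The set `P` together with the row of `m` cells from the corner `0` along the axis `j`. -/
def attachRow (j : Fin 3) (m : ℕ) (P : Finset Cell) : Finset Cell :=
  P ∪ (Finset.range m).image fun t : ℕ => Pi.single j (t : ℤ)

theorem mem_attachRow {j : Fin 3} {m : ℕ} {P : Finset Cell} {u : Cell} :
    u ∈ attachRow j m P ↔ u ∈ P ∨ (0 ≤ u j ∧ u j < m ∧ ∀ l, l ≠ j → u l = 0) := by
  simp only [attachRow, Finset.mem_union, Finset.mem_image, Finset.mem_range]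
  refine or_congr_right ⟨?_, ?_⟩
  · rintro ⟨t, ht, rfl⟩
    exact ⟨by simp, by simpa using ht, fun l hl => by simp [hl]⟩
  · rintro ⟨h1, h2, h3⟩
    refine ⟨(u j).toNat, by omega, ?_⟩
    ext l
    by_cases hl : l = j
    · subst hl; simpa using h1
    · simp [hl, h3 l hl]

/-- Each cell of `S` lies in the coordinate plane orthogonal to the axis `j`, or on that axis. -/
def IsPlaneWithRow (j : Fin 3) (S : Finset Cell) : Prop :=
  ∀ u ∈ S, u j = 0 ∨ ∀ l, l ≠ j → u l = 0

namespace IsCornerTree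

variable {n : Fin 3 → ℕ} {S P : Finset Cell}

theorem apply_eq_zero {j : Fin 3} (h : IsCornerTree (Function.update n j 1) P) {u : Cell}
    (hu : u ∈ P) : u j = 0 := by
  have := h.inPrism u hu j
  simp at this; omega

/-- The row and the planar tree share only the corner: steps along `j` lie in the row and all others
in `P`, so no layer boundary is crossed in both. -/
theorem attachRow {j : Fin 3} (h : IsCornerTree (Function.update n j 1) P) (hn : ∀ i, 1 ≤ n i) :
    IsCornerTree n (attachRow j (n j) P) where
  zero_mem := mem_attachRow.2 (Or.inl h.zero_mem)
  inPrism u hu l := by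
    have := hn l
    rcases mem_attachRow.1 hu with hu | ⟨h1, h2, h3⟩
    · have h1 := h.inPrism _ hu l
      by_cases hl : l = j
      · subst hl; simp at h1; omega
      · simpa [hl] using h1
    · by_cases hl : l = j
      · subst hl; exact ⟨h1, h2⟩
      · have := h3 l hl
        omega
  far l := by
    by_cases hl : l = j
    · subst hl
      have := hn l
      refine ⟨Pi.single l ((n l : ℤ) - 1), mem_attachRow.2 (Or.inr ⟨?_, ?_, ?_⟩), by simp⟩
      · simp; omega
      · simp
      · intro i hi; simp [hi]
    · obtain ⟨u, hu, hul⟩ := h.far l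
      exact ⟨u, mem_attachRow.2 (Or.inl hu), by simpa [hl] using hul⟩
  pred u hu hu0 := by
    rcases mem_attachRow.1 hu with hu | ⟨h1, h2, h3⟩
    · obtain ⟨i, hi⟩ := h.pred u hu hu0
      exact ⟨i, mem_attachRow.2 (Or.inl hi)⟩
    · have hj : u j ≠ 0 := fun h0 => hu0 (by
        ext l
        by_cases hl : l = j
        · subst hl; exact h0
        · exact h3 l hl)
      refine ⟨j, mem_attachRow.2 (Or.inr ⟨?_, ?_, fun l hl => ?_⟩)⟩
      · simp; omega
      · simp; omega
      · simp [hl, h3 l hl]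
  gap i u hu v hv hu' hv' huv := by
    have hnn : ∀ w ∈ _root_.attachRow j (n j) P, ∀ l, 0 ≤ w l := by
      intro w hw l
      rcases mem_attachRow.1 hw with hw | ⟨h1, h2, h3⟩
      · exact h.nonneg hw l
      · by_cases hl : l = j
        · subst hl; exact h1
        · exact (h3 l hl).ge
    have hpos : ∀ w, w - unitStep i ∈ _root_.attachRow j (n j) P → 1 ≤ w i := by
      intro w hw
      have := hnn _ hw i
      simp at this; omega
    by_cases hij : i = j
    · subst hij
      have key : ∀ w ∈ _root_.attachRow i (n i) P, 1 ≤ w i → ∀ l, l ≠ i → w l = 0 := by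
        intro w hw hwi
        rcases mem_attachRow.1 hw with hw | ⟨h1, h2, h3⟩
        · have := h.apply_eq_zero hw
          omega
        · exact h3
      ext l
      by_cases hl : l = i
      · rw [hl, huv]
      · rw [key u hu (hpos u hu') l hl, key v hv (hpos v hv') l hl]
    · have key : ∀ w ∈ _root_.attachRow j (n j) P, 1 ≤ w i → w ∈ P := by
        intro w hw hwi
        rcases mem_attachRow.1 hw with hw | ⟨h1, h2, h3⟩
        · exact hw
        · have := h3 i hij
          omega
      have key' : ∀ w ∈ P, w - unitStep i ∈ _root_.attachRow j (n j) P → w - unitStep i ∈ P := by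
        intro w hw hw'
        rcases mem_attachRow.1 hw' with hw' | ⟨h1, h2, h3⟩
        · exact hw'
        · have h0 : w - unitStep i = 0 := by
            ext l
            by_cases hl : l = j
            · subst hl; simp [h.apply_eq_zero hw, Ne.symm hij]
            · exact h3 l hl
          exact h0 ▸ h.zero_mem
      have hu1 := key u hu (hpos u hu')
      have hv1 := key v hv (hpos v hv')
      exact h.gap i u hu1 v hv1 (key' u hu1 hu') (key' v hv1 hv') huv

theorem cornerDirs_attachRow (j : Fin 3) {m : ℕ} (hm : 2 ≤ m) (P : Finset Cell) :
    cornerDirs (_root_.attachRow j m P) = insert j (cornerDirs P) := by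
  ext i
  rw [mem_cornerDirs, mem_attachRow, Finset.mem_insert, mem_cornerDirs, or_comm]
  refine or_congr_left ⟨fun ⟨_, _, h⟩ => ?_, ?_⟩
  · by_contra hij
    have := h i hij
    simp at this
  · rintro rfl
    exact ⟨by simp, by simp; omega, fun l hl => by simp [hl]⟩

theorem filter_attachRow {j : Fin 3} {m : ℕ} (h : IsCornerTree (Function.update n j 1) P) :
    (_root_.attachRow j m P).filter (fun u => u j = 0) = P := by
  ext u
  rw [Finset.mem_filter, mem_attachRow]
  constructor
  · rintro ⟨hu | ⟨h1, h2, h3⟩, h0⟩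
    · exact hu
    · have : u = 0 := by
        ext l
        by_cases hl : l = j
        · subst hl; exact h0
        · exact h3 l hl
      exact this ▸ h.zero_mem
  · exact fun hu => ⟨Or.inl hu, h.apply_eq_zero hu⟩

theorem filter_plane {j : Fin 3} (h : IsCornerTree n S) (hS : IsPlaneWithRow j S)
    (hn : ∀ i, 2 ≤ n i) :
    IsCornerTree (Function.update n j 1) (S.filter fun u => u j = 0) where
  zero_mem := Finset.mem_filter.2 ⟨h.zero_mem, rfl⟩
  inPrism u hu l := by
    obtain ⟨hu, h0⟩ := Finset.mem_filter.1 hu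
    by_cases hl : l = j
    · subst hl; simp [h0]
    · simpa [hl] using h.inPrism u hu l
  far l := by
    by_cases hl : l = j
    · subst hl
      exact ⟨0, Finset.mem_filter.2 ⟨h.zero_mem, rfl⟩, by simp⟩
    · obtain ⟨u, hu, hul⟩ := h.far l
      -- A cell of the axis `j` has coordinate `0` along `l`, so it is not in the last layer, since
      -- `n l` is at least two.
      refine ⟨u, Finset.mem_filter.2 ⟨hu, (hS u hu).resolve_right fun h3 => ?_⟩, ?_⟩
      · have := h3 l hl
        have := hn l
        omega
      · simpa [hl] using hul
  pred u hu hu0 := by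
    obtain ⟨hu, h0⟩ := Finset.mem_filter.1 hu
    obtain ⟨i, hi⟩ := h.pred u hu hu0
    have hij : j ≠ i := by
      rintro rfl
      have := h.one_le_apply hi
      omega
    exact ⟨i, Finset.mem_filter.2 ⟨hi, by simp [h0, hij]⟩⟩
  gap i u hu v hv hu' hv' huv :=
    h.gap i u (Finset.filter_subset _ _ hu) v (Finset.filter_subset _ _ hv)
      (Finset.filter_subset _ _ hu') (Finset.filter_subset _ _ hv') huv

theorem eq_attachRow {j : Fin 3} (h : IsCornerTree n S) (hS : IsPlaneWithRow j S)
    (hn : ∀ i, 2 ≤ n i) : S = _root_.attachRow j (n j) (S.filter fun u => u j = 0) := by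
  refine h.eq_of_subset ((h.filter_plane hS hn).attachRow fun i => one_le_two.trans (hn i)) ?_
  intro u hu
  rw [mem_attachRow, Finset.mem_filter]
  rcases hS u hu with h0 | h0
  · exact Or.inl ⟨hu, h0⟩
  · exact Or.inr ⟨h.nonneg hu j, (h.inPrism u hu j).2, h0⟩

end IsCornerTree

/-- Attaching the row is a bijection; its inverse takes the slice `u j = 0`. -/
theorem treeCount_planeWithRow {n : Fin 3 → ℕ} (hn : ∀ i, 2 ≤ n i) {i j : Fin 3} (hij : i ≠ j) :
    treeCount (fun S => IsPlaneWithRow j S ∧ cornerDirs S = {i, j}) n =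
      treeCount (fun S => cornerDirs S = {i}) (Function.update n j 1) := by
  have hn1 : ∀ i, 1 ≤ n i := fun i => one_le_two.trans (hn i)
  have hinj : Set.InjOn (attachRow j (n j))
      {P | IsCornerTree (Function.update n j 1) P ∧ cornerDirs P = {i}} := by
    intro P hP P' hP' h
    have := congrArg (Finset.filter fun u => u j = 0) h
    simpa only [hP.1.filter_attachRow, hP'.1.filter_attachRow] using this
  rw [treeCount, treeCount, ← hinj.ncard_image]
  congr 1
  ext S
  simp only [Set.mem_ofPred_eq, Set.mem_image]
  constructor
  · rintro ⟨h, hS, hd⟩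
    have hP := h.filter_plane hS hn
    refine ⟨_, ⟨hP, ?_⟩, (h.eq_attachRow hS hn).symm⟩
    have h1 := IsCornerTree.cornerDirs_attachRow j (hn j) (S.filter fun u => u j = 0)
    rw [← h.eq_attachRow hS hn, hd] at h1
    have h2 : j ∉ cornerDirs (S.filter fun u => u j = 0) := fun hj => by
      have := hP.two_le hj
      simp at this
    ext l
    have h3 := congrArg (l ∈ ·) h1
    simp only [Finset.mem_insert, Finset.mem_singleton, eq_iff_iff] at h3
    rw [Finset.mem_singleton]
    by_cases hl : l = j
    · subst hl; simp [h2, hij.symm]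
    · simpa [hl] using h3.symm
  · rintro ⟨P, ⟨hP, hd⟩, rfl⟩
    refine ⟨hP.attachRow hn1, ?_, ?_⟩
    · intro u hu
      rcases mem_attachRow.1 hu with hu | ⟨-, -, h3⟩
      · exact Or.inl (hP.apply_eq_zero hu)
      · exact Or.inr h3
    · rw [IsCornerTree.cornerDirs_attachRow j (hn j), hd, Finset.pair_comm]

/-- Cells have `u i = 0` or `u j = 0`, and the first layer boundary along the third axis `k` is
crossed only once. Only one of the two branches can therefore extend along `k`; the other is a
straight row. As `n k` is at least two, exactly one branch does extend. -/
theorem treeCount_pair {n : Fin 3 → ℕ} (hn : ∀ i, 2 ≤ n i) {i j k : Fin 3} (hij : i ≠ j)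
    (hik : k ≠ i) (hjk : k ≠ j) :
    treeCount (fun S => cornerDirs S = {i, j}) n =
      treeCount (fun S => cornerDirs S = {i}) (Function.update n j 1) +
        treeCount (fun S => cornerDirs S = {j}) (Function.update n i 1) := by
  have hcases : ∀ l, l = i ∨ l = j ∨ l = k := by omega
  rw [← treeCount_planeWithRow hn hij, ← treeCount_planeWithRow hn hij.symm, treeCount, treeCount,
    treeCount, ← Set.ncard_union_eq ?_ (finite_isCornerTree _ _) (finite_isCornerTree _ _)]
  · congr 1
    ext S
    simp only [Set.mem_ofPred_eq, Set.mem_union, Finset.pair_comm j i]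
    refine ⟨fun ⟨h, hd⟩ => ?_, by rintro (⟨h, -, hd⟩ | ⟨h, -, hd⟩) <;> exact ⟨h, hd⟩⟩
    by_contra hno
    have h1 : ¬ IsPlaneWithRow j S := fun h1 => hno (Or.inl ⟨h, h1, hd⟩)
    have h2 : ¬ IsPlaneWithRow i S := fun h2 => hno (Or.inr ⟨h, h2, hd⟩)
    have hi : i ∈ cornerDirs S := by simp [hd]
    have hj : j ∈ cornerDirs S := by simp [hd]
    have hz := h.eq_zero_or_eq_zero hi hj hij
    simp only [IsPlaneWithRow, not_forall, not_or] at h1 h2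
    obtain ⟨u, hu, huj, l, hl, hul⟩ := h1
    obtain ⟨v, hv, hvi, m, hm, hvm⟩ := h2
    have hui := (hz u hu).resolve_right huj
    have hvj := (hz v hv).resolve_left hvi
    have hlk : l = k := by
      rcases hcases l with rfl | rfl | rfl
      · exact absurd hui hul
      · exact absurd rfl hl
      · rfl
    have hmk : m = k := by
      rcases hcases m with rfl | rfl | rfl
      · exact absurd rfl hm
      · exact absurd hvj hvm
      · rfl
    subst hlk
    subst hmk
    have huk := h.nonneg hu m
    have hvk := h.nonneg hv m
    -- Both paths leave the face orthogonal to the third axis at the same cell `w`, which lies below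
    -- `u` and below `v`. Thus `w` vanishes along `i` and `j`, so it is a neighbour of the corner
    -- along an axis that is not a corner direction.
    obtain ⟨w, hw, hw', hw1, hwu⟩ := h.exists_first_step m u hu (by omega)
    obtain ⟨w', hww, hww', hww1, hwv⟩ := h.exists_first_step m v hv (by omega)
    have hww : w = w' := h.gap m w hw w' hww hw' hww' (by rw [hw1, hww1])
    subst hww
    have h0 : w - unitStep m ≠ 0 := fun h0 => by
      have : m ∈ cornerDirs S := mem_cornerDirs.2 (sub_eq_zero.1 h0 ▸ hw)
      rw [hd, Finset.mem_insert, Finset.mem_singleton] at this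
      exact this.elim hik hjk
    obtain ⟨p, hp, hp1⟩ := h.exists_mem_cornerDirs hw' h0
    rw [hd, Finset.mem_insert, Finset.mem_singleton] at hp
    rcases hp with rfl | rfl
    · have : w p ≤ u p := hwu p
      simp [hik.symm] at hp1; omega
    · have : w p ≤ v p := hwv p
      simp [hjk.symm] at hp1; omega
  · rw [Set.disjoint_left]
    rintro S ⟨h, h1, hd⟩ ⟨-, h2, -⟩
    -- If both descriptions held, a cell of the last layer along `k` would vanish along both corner
    -- directions.
    obtain ⟨v, hv, hvk⟩ := h.far k
    have hk := hn k
    have hvk' : v k ≠ 0 := by omega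
    have hj : v j = 0 := (h1 v hv).resolve_right fun h3 => hvk' (h3 k hjk)
    have hi : v i = 0 := (h2 v hv).resolve_right fun h3 => hvk' (h3 k hik)
    obtain ⟨p, hp, hp1⟩ := h.exists_mem_cornerDirs hv (fun h0 => hvk' (by rw [h0]; rfl))
    rw [hd, Finset.mem_insert, Finset.mem_singleton] at hp
    rcases hp with rfl | rfl <;> omega

/-! ### The remaining sets of corner directions and the recurrence -/

theorem treeCount_univ (n : Fin 3 → ℕ) :
    treeCount (fun S => cornerDirs S = Finset.univ) n = if ∀ i, 2 ≤ n i then 1 else 0 := by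
  split_ifs with hn
  · have hn1 : ∀ i, 1 ≤ n i := fun i => one_le_two.trans (hn i)
    refine treeCount_axesSet hn1 fun S h => ⟨fun hd => h.eq_axesSet fun u hu => ?_, ?_⟩
    · have hz := fun i j => h.eq_zero_or_eq_zero (i := i) (j := j) (by simp [hd]) (by simp [hd])
      by_cases h0 : ∃ i, u i ≠ 0
      · obtain ⟨i, hi⟩ := h0
        exact ⟨i, fun l hl => (hz i l hl.symm u hu).resolve_left hi⟩
      · push Not at h0
        exact ⟨0, fun l _ => h0 l⟩
    · rintro rfl
      rw [cornerDirs_axesSet hn1, Finset.filter_true_of_mem fun i _ => hn i]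
  · refine treeCount_eq_zero fun S h hd => hn fun i => h.two_le (by simp [hd])

theorem treeCount_flat_pair {n : Fin 3 → ℕ} {i j k : Fin 3} (hij : i ≠ j)
    (hik : k ≠ i) (hjk : k ≠ j) (hk : n k = 1) :
    treeCount (fun S => cornerDirs S = {i, j}) n = if 2 ≤ n i ∧ 2 ≤ n j then 1 else 0 := by
  have hcases : ∀ l, l = i ∨ l = j ∨ l = k := by omega
  split_ifs with hn
  · have hn1 : ∀ i, 1 ≤ n i := fun l => by
      rcases hcases l with rfl | rfl | rfl <;> omega
    refine treeCount_axesSet hn1 fun S h => ⟨fun hd => h.eq_axesSet fun u hu => ?_, ?_⟩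
    · have huk : u k = 0 := by
        have := h.inPrism u hu k
        omega
      rcases h.eq_zero_or_eq_zero (i := i) (j := j) (by simp [hd]) (by simp [hd]) hij u hu
        with h0 | h0
      · refine ⟨j, fun l hl => ?_⟩
        rcases hcases l with rfl | rfl | rfl <;> first | assumption | exact absurd rfl hl
      · refine ⟨i, fun l hl => ?_⟩
        rcases hcases l with rfl | rfl | rfl <;> first | assumption | exact absurd rfl hl
    · rintro rfl
      rw [cornerDirs_axesSet hn1]
      ext l
      simp only [Finset.mem_filter, Finset.mem_univ, true_and, Finset.mem_insert,
        Finset.mem_singleton]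
      rcases hcases l with rfl | rfl | rfl
      · simp [hn.1]
      · simp [hn.2]
      · simp [hk, hik, hjk]
  · refine treeCount_eq_zero fun S h hd => hn ⟨h.two_le (by simp [hd]), h.two_le (by simp [hd])⟩

theorem treeCount_of_mem_of_eq_one {n : Fin 3 → ℕ} {Q : Finset Cell → Prop} {D : Finset (Fin 3)}
    {i : Fin 3} (hi : i ∈ D) (hn : n i = 1) :
    treeCount (fun S => Q S ∧ cornerDirs S = D) n = 0 :=
  treeCount_eq_zero fun S h hd => by
    have := h.two_le (hd.2 ▸ hi)
    omega

theorem treeCount_empty {Q : Finset Cell → Prop} {n : Fin 3 → ℕ} (hQ : n = 1 → Q {0}) :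
    treeCount (fun S => Q S ∧ cornerDirs S = ∅) n = if n = 1 then 1 else 0 := by
  have key : ∀ S, IsCornerTree n S → cornerDirs S = ∅ → S = {0} := fun S h hd => by
    refine (Finset.eq_singleton_iff_unique_mem.2 ⟨h.zero_mem, fun u hu => ?_⟩)
    by_contra hu0
    obtain ⟨i, hi, -⟩ := h.exists_mem_cornerDirs hu hu0
    simp [hd] at hi
  split_ifs with hn
  · subst hn
    have hax : axesSet 1 = {0} := key _ (isCornerTree_axesSet (by simp)) (by
      rw [cornerDirs_axesSet (by simp)]; simp)
    refine treeCount_axesSet (by simp) fun S h => ⟨fun hd => hax ▸ key S h hd.2, ?_⟩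
    rintro rfl
    refine ⟨hax ▸ hQ rfl, ?_⟩
    rw [cornerDirs_axesSet (by simp)]; simp
  · refine treeCount_eq_zero fun S h hd => hn ?_
    obtain rfl := key S h hd.2
    ext i
    obtain ⟨u, hu, hui⟩ := h.far i
    rw [Finset.mem_singleton] at hu
    subst hu
    simp at hui ⊢; omega

theorem sum_finset_fin_three (f : Finset (Fin 3) → ℕ) :
    ∑ D, f D = f ∅ + ∑ i, f {i} + (f {0, 1} + f {0, 2} + f {1, 2}) + f Finset.univ := by
  have h : (Finset.univ : Finset (Finset (Fin 3))) =
      {∅, {0}, {1}, {2}, {0, 1}, {0, 2}, {1, 2}, Finset.univ} := by decide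
  rw [h, Finset.sum_insert (by decide), Finset.sum_insert (by decide), Finset.sum_insert (by decide),
    Finset.sum_insert (by decide), Finset.sum_insert (by decide), Finset.sum_insert (by decide),
    Finset.sum_insert (by decide), Finset.sum_singleton, Fin.sum_univ_three]
  ring

/-- The number `f (n - unitStep i)`, zero if `n i = 0`. -/
def shiftAlong {M : Type*} [Zero M] (i : Fin 3) (f : (Fin 3 → ℕ) → M) (n : Fin 3 → ℕ) : M :=
  if n i = 0 then 0 else f (n - Pi.single i 1)

/-- For a property unaffected by prepending a cell, the trees with a single corner direction are
counted by the same function on the shortened prism. The other direction sets are the source terms.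
-/
theorem treeCount_rec {Q : (Fin 3 → ℕ) → Finset Cell → Prop}
    (hQ : ∀ n i S, IsCornerTree n S → (Q (n + Pi.single i 1) (prependStep i S) ↔ Q n S))
    (h1 : Q 1 {0}) (n : Fin 3 → ℕ) :
    treeCount (Q n) n = (if n = 1 then 1 else 0) +
      ∑ i, shiftAlong i (fun n => treeCount (Q n) n) n +
      (treeCount (fun S => Q n S ∧ cornerDirs S = {0, 1}) n +
        treeCount (fun S => Q n S ∧ cornerDirs S = {0, 2}) n +
        treeCount (fun S => Q n S ∧ cornerDirs S = {1, 2}) n) +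
      treeCount (fun S => Q n S ∧ cornerDirs S = Finset.univ) n := by
  rw [treeCount_eq_sum, sum_finset_fin_three, treeCount_empty (by rintro rfl; exact h1)]
  congr 3
  refine Finset.sum_congr rfl fun i _ => ?_
  rw [shiftAlong]
  split_ifs with hi
  · refine treeCount_eq_zero fun S h => ?_
    have := h.one_le i
    omega
  · have hn : n = (n - Pi.single i 1) + Pi.single i 1 := by
      ext l
      by_cases hl : l = i
      · subst hl; simp; omega
      · simp [hl]
    conv_lhs => rw [hn]
    exact treeCount_singleton fun S hS => hQ _ i S hS

/-! ### The families in terms of corner trees -/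

/-- The cell of the prism of size `n` in the corner opposite to `0`. -/
def farCorner (n : Fin 3 → ℕ) : Cell := fun i => (n i : ℤ) - 1

/-- The coordinate sum records the time along the path, so the path is injective and its length is
determined by its endpoint. -/
theorem IsCornerTree.exists_path {n : Fin 3 → ℕ} {S : Finset Cell} (h : IsCornerTree n S) :
    ∀ u ∈ S, ∃ (N : ℕ) (p : ℕ → Cell), p 0 = 0 ∧ p N = u ∧
      (∀ t < N, ∃ i : Fin 3, p (t + 1) = p t + unitStep i) ∧
      ∀ t ≤ N, p t ∈ S ∧ ∑ i, p t i = t := by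
  refine h.induction ⟨0, 0, by simp [h.zero_mem]⟩ ?_
  rintro u hu i hi ⟨N, p, hp0, hpN, hstep, hp⟩
  refine ⟨N + 1, fun t => if t ≤ N then p t else u, by simp [hp0], by simp, ?_, ?_⟩
  · intro t ht
    rcases Nat.lt_succ_iff_lt_or_eq.1 ht with ht | rfl
    · obtain ⟨l, hl⟩ := hstep t ht
      exact ⟨l, by simp [ht.le, Nat.succ_le_of_lt ht, hl]⟩
    · exact ⟨i, by simp [hpN]⟩
  · intro t ht
    rcases Nat.le_succ_iff.1 ht with ht | rfl
    · simpa [ht] using hp t ht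
    · have h1 := (hp N le_rfl).2
      rw [hpN] at h1
      simp only [Pi.sub_apply, Finset.sum_sub_distrib] at h1
      simp at h1 ⊢
      exact ⟨hu, by omega⟩

/-- A path of positive steps to the opposite corner already has `∑ (n i - 1) + 1` cells, so it
exhausts a corner tree. -/
theorem isStair_iff {n : Fin 3 → ℕ} {S : Finset Cell} :
    IsStair n S ↔ IsCornerTree n S ∧ farCorner n ∈ S := by
  constructor
  · rintro ⟨h, N, p, hp0, hpN, -, hS⟩
    have hmem : ∀ t ≤ N, p t ∈ S := fun t ht => by
      rw [hS]; exact Finset.mem_image_of_mem p (by simpa [Nat.lt_succ_iff] using ht)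
    refine ⟨h.isCornerTree (hp0 ▸ hmem 0 (Nat.zero_le N)), ?_⟩
    have : farCorner n = p N := funext fun i => (hpN i).symm
    exact this ▸ hmem N le_rfl
  · rintro ⟨h, htop⟩
    obtain ⟨N, p, hp0, hpN, hstep, hp⟩ := h.exists_path _ htop
    refine ⟨h.isMinimalInscribed, N, p, hp0, fun i => by rw [hpN, farCorner], hstep, ?_⟩
    symm
    refine Finset.eq_of_subset_of_card_le ?_ ?_
    · intro u hu
      obtain ⟨t, ht, rfl⟩ := Finset.mem_image.1 hu
      exact (hp t (by simpa [Nat.lt_succ_iff] using ht)).1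
    · rw [Finset.card_image_of_injOn, Finset.card_range]
      · have h1 := (hp N le_rfl).2
        have h2 := h.card_le
        rw [hpN] at h1
        simp only [farCorner] at h1
        omega
      · intro s hs t ht hst
        have h1 := (hp s (by simpa [Nat.lt_succ_iff] using hs)).2
        have h2 := (hp t (by simpa [Nat.lt_succ_iff] using ht)).2
        rw [hst, h2] at h1
        exact_mod_cast h1.symm

theorem isTripod_iff {n : Fin 3 → ℕ} {S : Finset Cell} :
    IsTripod n S ↔ IsCornerTree n S ∧ cornerDirs S = Finset.univ := by
  rw [IsTripod, isCornerPolyomino_iff]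
  refine and_congr_right fun h => ?_
  rw [h.cellDegree_zero, ← Finset.card_eq_iff_eq_univ, Fintype.card_fin]

theorem isDegTwoCorner_iff {n : Fin 3 → ℕ} {S : Finset Cell} :
    IsDegTwoCorner n S ↔ IsCornerTree n S ∧ ((∀ i, 2 ≤ n i) ∧ (cornerDirs S).card = 2) := by
  rw [IsDegTwoCorner, isCornerPolyomino_iff, and_left_comm]
  refine and_congr_right fun h => ?_
  rw [h.cellDegree_zero]

/-- One side of the prism has length one, the other two have length at least two. -/
def IsFlat (n : Fin 3 → ℕ) : Prop :=
  ∃ i j : Fin 3, i ≠ j ∧ 2 ≤ n i ∧ 2 ≤ n j ∧ ∀ l, l ≠ i → l ≠ j → n l = 1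

theorem IsFlat.one_le {n : Fin 3 → ℕ} (h : IsFlat n) (l : Fin 3) : 1 ≤ n l := by
  obtain ⟨i, j, -, hi, hj, hl⟩ := h
  by_cases h1 : l = i
  · subst h1; omega
  · by_cases h2 : l = j
    · subst h2; omega
    · exact (hl l h1 h2).ge

theorem isFlatHook_iff {n : Fin 3 → ℕ} {S : Finset Cell} :
    IsFlatHook n S ↔ IsCornerTree n S ∧ (IsFlat n ∧ S = axesSet n) := by
  have key : ∀ i j : Fin 3, i ≠ j → (∀ l, l ≠ i → l ≠ j → n l = 1) → ∀ u : Cell,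
      u ∈ axesSet n ↔ InPrism n u ∧ (u i = 0 ∨ u j = 0) := by
    intro i j hij hl u
    rw [mem_axesSet]
    refine and_congr_right fun hu => ⟨?_, ?_⟩
    · rintro ⟨m, hm⟩
      by_cases hi : i = m
      · exact Or.inr (hm j (hi ▸ hij.symm))
      · exact Or.inl (hm i hi)
    · have h0 : ∀ l, l ≠ i → l ≠ j → u l = 0 := fun l h1 h2 => by
        have := hu l
        rw [hl l h1 h2] at this
        omega
      rintro (hi | hj)
      · refine ⟨j, fun l hlj => ?_⟩
        by_cases hli : l = i
        · exact hli ▸ hi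
        · exact h0 l hli hlj
      · refine ⟨i, fun l hli => ?_⟩
        by_cases hlj : l = j
        · exact hlj ▸ hj
        · exact h0 l hli hlj
  constructor
  · rintro ⟨i, j, hij, hi, hj, hl, hS⟩
    have hflat : IsFlat n := ⟨i, j, hij, hi, hj, hl⟩
    have : S = axesSet n := by
      ext u
      rw [hS, key i j hij hl]
    exact ⟨this ▸ isCornerTree_axesSet hflat.one_le, hflat, this⟩
  · rintro ⟨-, ⟨i, j, hij, hi, hj, hl⟩, rfl⟩
    exact ⟨i, j, hij, hi, hj, hl, key i j hij hl⟩

open Classical in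
theorem treeCount_flat (n : Fin 3 → ℕ) :
    treeCount (fun S => IsFlat n ∧ S = axesSet n) n = if IsFlat n then 1 else 0 := by
  split_ifs with h
  · exact treeCount_axesSet h.one_le fun S _ => by simp [h]
  · exact treeCount_eq_zero fun S _ hS => h hS.1

/-! ### Recurrences for all corner trees and for stairs -/

theorem treeCount_card_eq_two {n : Fin 3 → ℕ} (hn : ∀ i, 2 ≤ n i) :
    treeCount (fun S => (∀ i, 2 ≤ n i) ∧ (cornerDirs S).card = 2) n =
      treeCount (fun S => cornerDirs S = {0, 1}) n + treeCount (fun S => cornerDirs S = {0, 2}) n +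
        treeCount (fun S => cornerDirs S = {1, 2}) n := by
  have h0 : ∀ D : Finset (Fin 3), D.card ≠ 2 →
      treeCount (fun S => ((∀ i, 2 ≤ n i) ∧ (cornerDirs S).card = 2) ∧ cornerDirs S = D) n = 0 :=
    fun D hD => treeCount_eq_zero fun S _ hS => hD (hS.2 ▸ hS.1.2)
  have h2 : ∀ D : Finset (Fin 3), D.card = 2 →
      treeCount (fun S => ((∀ i, 2 ≤ n i) ∧ (cornerDirs S).card = 2) ∧ cornerDirs S = D) n =
        treeCount (fun S => cornerDirs S = D) n := by
    intro D hD
    congr 1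
    ext S
    exact ⟨fun h => h.2, fun h => ⟨⟨hn, h ▸ hD⟩, h⟩⟩
  rw [treeCount_eq_sum, sum_finset_fin_three, Fin.sum_univ_three, h0 ∅ (by decide),
    h0 {0} (by decide), h0 {1} (by decide), h0 {2} (by decide), h0 Finset.univ (by decide),
    h2 {0, 1} (by decide), h2 {0, 2} (by decide), h2 {1, 2} (by decide)]
  ring

/-- The number of corner trees. -/
noncomputable abbrev cornerCount : (Fin 3 → ℕ) → ℕ := treeCount fun _ => True

theorem cornerCount_eq_zero {n : Fin 3 → ℕ} {i : Fin 3} (hi : n i = 0) : cornerCount n = 0 :=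
  treeCount_eq_zero fun S h => by
    have := h.one_le i
    omega

theorem cornerCount_rec (n : Fin 3 → ℕ) :
    cornerCount n = (if n = 1 then 1 else 0) + ∑ i, shiftAlong i cornerCount n +
      (treeCount (fun S => cornerDirs S = {0, 1}) n +
        treeCount (fun S => cornerDirs S = {0, 2}) n +
        treeCount (fun S => cornerDirs S = {1, 2}) n) + if ∀ i, 2 ≤ n i then 1 else 0 := by
  rw [← treeCount_univ]
  simpa using treeCount_rec (Q := fun _ _ => True) (by simp) trivial n

theorem treeCount_pair_of_eq_one {n : Fin 3 → ℕ} {D : Finset (Fin 3)} {i : Fin 3} (hi : i ∈ D)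
    (hn : n i = 1) : treeCount (fun S => cornerDirs S = D) n = 0 := by
  simpa using treeCount_of_mem_of_eq_one (Q := fun _ => True) hi hn

/-- In the flat prism the corner directions are `{i}`, `{k}` or `{i, k}`; the summand `1` is the
single hook of the last kind. -/
theorem treeCount_singleton_add {n : Fin 3 → ℕ} (hn : ∀ i, 2 ≤ n i) {i j k : Fin 3} (hij : i ≠ j)
    (hik : k ≠ i) (hjk : k ≠ j) :
    treeCount (fun S => cornerDirs S = {i}) (Function.update n j 1) +
      treeCount (fun S => cornerDirs S = {k}) (Function.update n j 1) + 1 =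
        cornerCount (Function.update n j 1) := by
  set m := Function.update n j 1 with hm
  have hmj : m j = 1 := by simp [hm]
  have hmi : 2 ≤ m i := by simpa [hm, hij] using hn i
  have hmk : 2 ≤ m k := by simpa [hm, hjk] using hn k
  have hpair : treeCount (fun S => cornerDirs S = {i, k}) m = 1 := by
    rw [treeCount_flat_pair hik.symm hij.symm hjk.symm hmj, if_pos ⟨hmi, hmk⟩]
  have hz : ∀ D, j ∈ D → treeCount (fun S => cornerDirs S = D) m = 0 := fun D hD =>
    treeCount_pair_of_eq_one hD hmj
  have hempty : treeCount (fun S => cornerDirs S = ∅) m = 0 := by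
    have := treeCount_empty (Q := fun _ => True) (n := m) (fun _ => trivial)
    simp only [true_and] at this
    rw [this, if_neg]
    intro h1
    have := congrFun h1 i
    simp at this; omega
  have htot := treeCount_eq_sum (fun _ => True) m
  rw [sum_finset_fin_three, Fin.sum_univ_three] at htot
  simp only [true_and] at htot
  rw [hempty, hz Finset.univ (Finset.mem_univ j)] at htot
  have hp' := hpair
  rw [Finset.pair_comm] at hp'
  have hj := hz {j} (by simp)
  have hji := hz {j, i} (by simp)
  have hjk' := hz {j, k} (by simp)
  have hij' := hz {i, j} (by simp)
  have hkj' := hz {k, j} (by simp)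
  clear_value m
  rw [cornerCount, htot]
  have hcases : ∀ i j k : Fin 3, i ≠ j → k ≠ i → k ≠ j →
      (i = 0 ∧ j = 1 ∧ k = 2) ∨ (i = 0 ∧ j = 2 ∧ k = 1) ∨ (i = 1 ∧ j = 0 ∧ k = 2) ∨
      (i = 1 ∧ j = 2 ∧ k = 0) ∨ (i = 2 ∧ j = 0 ∧ k = 1) ∨ (i = 2 ∧ j = 1 ∧ k = 0) := by decide
  rcases hcases i j k hij hik hjk with ⟨rfl, rfl, rfl⟩ | ⟨rfl, rfl, rfl⟩ | ⟨rfl, rfl, rfl⟩ | ⟨rfl, rfl, rfl⟩ |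
    ⟨rfl, rfl, rfl⟩ | ⟨rfl, rfl, rfl⟩ <;> omega

/-- Summed over the three pairs of directions, `treeCount_pair` uses every coordinate plane twice,
once for each single direction in it. Each plane lacks only its hook, whence the `3`. -/
theorem treeCount_card_eq_two_add {n : Fin 3 → ℕ} (hn : ∀ i, 2 ≤ n i) :
    treeCount (fun S => (∀ i, 2 ≤ n i) ∧ (cornerDirs S).card = 2) n + 3 =
      ∑ j, cornerCount (Function.update n j 1) := by
  rw [treeCount_card_eq_two hn, treeCount_pair hn (k := 2) (by decide) (by decide) (by decide),
    treeCount_pair hn (k := 1) (by decide) (by decide) (by decide),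
    treeCount_pair hn (k := 0) (by decide) (by decide) (by decide), Fin.sum_univ_three,
    ← treeCount_singleton_add hn (i := 1) (j := 0) (k := 2) (by decide) (by decide) (by decide),
    ← treeCount_singleton_add hn (i := 0) (j := 1) (k := 2) (by decide) (by decide) (by decide),
    ← treeCount_singleton_add hn (i := 0) (j := 2) (k := 1) (by decide) (by decide) (by decide)]
  ring

open Classical in
/-- The corner cells of degree two belong to the properly three-dimensional corner-polyominoes and
to the flat hooks. -/
theorem sum_treeCount_pair (n : Fin 3 → ℕ) :
    treeCount (fun S => cornerDirs S = {0, 1}) n + treeCount (fun S => cornerDirs S = {0, 2}) n +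
      treeCount (fun S => cornerDirs S = {1, 2}) n =
    treeCount (fun S => (∀ i, 2 ≤ n i) ∧ (cornerDirs S).card = 2) n +
      if IsFlat n then 1 else 0 := by
  by_cases hn : ∀ i, 2 ≤ n i
  · rw [treeCount_card_eq_two hn, if_neg, add_zero]
    rintro ⟨i, j, hij, -, -, h⟩
    obtain ⟨l, hl⟩ : ∃ l, l ≠ i ∧ l ≠ j := by
      have : ∀ i j : Fin 3, ∃ l, l ≠ i ∧ l ≠ j := by decide
      exact this i j
    have := h l hl.1 hl.2
    have := hn l
    omega
  have hdeg : treeCount (fun S => (∀ i, 2 ≤ n i) ∧ (cornerDirs S).card = 2) n = 0 :=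
    treeCount_eq_zero fun S _ h => hn h.1
  rw [hdeg, zero_add]
  push Not at hn
  obtain ⟨k, hk⟩ := hn
  rcases Nat.lt_succ_iff_lt_or_eq.1 hk with hk | hk
  · have hz : ∀ D, treeCount (fun S => cornerDirs S = D) n = 0 := fun D =>
      treeCount_eq_zero fun S h => by
        have := h.one_le k
        omega
    rw [hz, hz, hz, if_neg]
    intro h
    have := h.one_le k
    omega
  · have hz : ∀ D, k ∈ D → treeCount (fun S => cornerDirs S = D) n = 0 := fun D hD =>
      treeCount_pair_of_eq_one hD hk
    have hflat : ∀ i j, i ≠ j → k ≠ i → k ≠ j →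
        treeCount (fun S => cornerDirs S = {i, j}) n = if IsFlat n then 1 else 0 := by
      intro i j hij hki hkj
      rw [treeCount_flat_pair hij hki hkj hk]
      refine if_congr ⟨fun h => ⟨i, j, hij, h.1, h.2, fun l hi hj => ?_⟩, ?_⟩ rfl rfl
      · have : l = k := by omega
        exact this ▸ hk
      · rintro ⟨i', j', hij', hi', hj', h⟩
        have hki' : k ≠ i' := by rintro rfl; omega
        have hkj' : k ≠ j' := by rintro rfl; omega
        have : (i = i' ∧ j = j') ∨ (i = j' ∧ j = i') := by omega
        rcases this with ⟨rfl, rfl⟩ | ⟨rfl, rfl⟩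
        · exact ⟨hi', hj'⟩
        · exact ⟨hj', hi'⟩
    have : k = 0 ∨ k = 1 ∨ k = 2 := by omega
    rcases this with rfl | rfl | rfl
    · rw [hz {0, 1} (by simp), hz {0, 2} (by simp), hflat 1 2 (by decide) (by decide) (by decide)]
      ring
    · rw [hz {0, 1} (by simp), hz {1, 2} (by simp), hflat 0 2 (by decide) (by decide) (by decide)]
      ring
    · rw [hz {0, 2} (by simp), hz {1, 2} (by simp), hflat 0 1 (by decide) (by decide) (by decide)]
      ring

/-- With two corner directions both corresponding sides have length at least two, while every cell
vanishes along one of them; the opposite corner is then excluded. Only the empty set and the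
singletons contribute. -/
theorem stairCount_rec (n : Fin 3 → ℕ) :
    treeCount (fun S => farCorner n ∈ S) n = (if n = 1 then 1 else 0) +
      ∑ i, shiftAlong i (fun n => treeCount (fun S => farCorner n ∈ S) n) n := by
  have hz : ∀ D : Finset (Fin 3), ∀ i j, i ∈ D → j ∈ D → i ≠ j →
      treeCount (fun S => farCorner n ∈ S ∧ cornerDirs S = D) n = 0 := by
    intro D i j hi hj hij
    refine treeCount_eq_zero fun S h hS => ?_
    obtain ⟨hS, rfl⟩ := hS
    have h1 := h.two_le hi
    have h2 := h.two_le hj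
    have := h.eq_zero_or_eq_zero hi hj hij _ hS
    simp only [farCorner] at this
    omega
  have hrec := treeCount_rec (Q := fun n S => farCorner n ∈ S) ?_ ?_ n
  · rw [hz {0, 1} 0 1 (by simp) (by simp) (by simp), hz {0, 2} 0 2 (by simp) (by simp) (by simp),
      hz {1, 2} 1 2 (by simp) (by simp) (by simp),
      hz Finset.univ 0 1 (by simp) (by simp) (by simp)] at hrec
    exact hrec
  · intro n i S h
    have h1 : farCorner (n + Pi.single i 1) = farCorner n + unitStep i := by
      ext l
      by_cases hl : l = i
      · subst hl; simp [farCorner]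
      · simp [farCorner, hl]
    rw [h1, mem_prependStep, add_sub_cancel_right]
    refine or_iff_right fun h0 => ?_
    have h2 := congrFun h0 i
    have := h.one_le i
    simp [farCorner] at h2
    omega
  · have : farCorner 1 = 0 := by ext i; simp [farCorner]
    rw [this]; simp

/-! ### Power series as coefficient arrays -/

/-- The power series in three variables with the given coefficients. -/
def seriesOf (f : ℕ → ℕ → ℕ → ℚ) : MvPowerSeries (Fin 3) ℚ := fun m => f (m 0) (m 1) (m 2)

theorem coeff_seriesOf (f : ℕ → ℕ → ℕ → ℚ) (m : Fin 3 →₀ ℕ) :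
    MvPowerSeries.coeff m (seriesOf f) = f (m 0) (m 1) (m 2) := rfl

theorem coeff_X_mul_eq_ite (i : Fin 3) (F : MvPowerSeries (Fin 3) ℚ) (m : Fin 3 →₀ ℕ) :
    MvPowerSeries.coeff m (MvPowerSeries.X i * F) =
      if m i = 0 then 0 else MvPowerSeries.coeff (m - Finsupp.single i 1) F := by
  rw [MvPowerSeries.X, MvPowerSeries.coeff_monomial_mul, one_mul]
  simp only [Finsupp.single_le_iff]
  split_ifs <;> first | rfl | omega

theorem X_zero_mul_seriesOf (f : ℕ → ℕ → ℕ → ℚ) :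
    MvPowerSeries.X 0 * seriesOf f = seriesOf fun a b c => if a = 0 then 0 else f (a - 1) b c := by
  ext m
  simp [coeff_X_mul_eq_ite, coeff_seriesOf]

theorem X_one_mul_seriesOf (f : ℕ → ℕ → ℕ → ℚ) :
    MvPowerSeries.X 1 * seriesOf f = seriesOf fun a b c => if b = 0 then 0 else f a (b - 1) c := by
  ext m
  simp [coeff_X_mul_eq_ite, coeff_seriesOf]

theorem X_two_mul_seriesOf (f : ℕ → ℕ → ℕ → ℚ) :
    MvPowerSeries.X 2 * seriesOf f = seriesOf fun a b c => if c = 0 then 0 else f a b (c - 1) := by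
  ext m
  simp [coeff_X_mul_eq_ite, coeff_seriesOf]

theorem seriesOf_add (f g : ℕ → ℕ → ℕ → ℚ) :
    seriesOf f + seriesOf g = seriesOf fun a b c => f a b c + g a b c := rfl

theorem seriesOf_sub (f g : ℕ → ℕ → ℕ → ℚ) :
    seriesOf f - seriesOf g = seriesOf fun a b c => f a b c - g a b c := rfl

theorem X_pow_mul_eq_seriesOf (i j k : ℕ) :
    (MvPowerSeries.X 0 ^ i * MvPowerSeries.X 1 ^ j * MvPowerSeries.X 2 ^ k :
      MvPowerSeries (Fin 3) ℚ) = seriesOf fun a b c => if a = i ∧ b = j ∧ c = k then 1 else 0 := by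
  classical
  ext m
  rw [MvPowerSeries.X_pow_eq, MvPowerSeries.X_pow_eq, MvPowerSeries.X_pow_eq,
    MvPowerSeries.monomial_mul_monomial, MvPowerSeries.monomial_mul_monomial,
    MvPowerSeries.coeff_monomial, coeff_seriesOf, mul_one, mul_one]
  refine if_congr ?_ rfl rfl
  constructor
  · rintro rfl
    simp
  · rintro ⟨h0, h1, h2⟩
    ext l
    fin_cases l <;> simp [h0, h1, h2]

theorem one_sub_X_zero_mul {f g : ℕ → ℕ → ℕ → ℚ}
    (h : ∀ a b c, f a b c - (if a = 0 then 0 else f (a - 1) b c) = g a b c) :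
    (1 - MvPowerSeries.X 0) * seriesOf f = seriesOf g := by
  rw [sub_mul, one_mul, X_zero_mul_seriesOf, seriesOf_sub]
  simp only [h]

theorem one_sub_X_one_mul {f g : ℕ → ℕ → ℕ → ℚ}
    (h : ∀ a b c, f a b c - (if b = 0 then 0 else f a (b - 1) c) = g a b c) :
    (1 - MvPowerSeries.X 1) * seriesOf f = seriesOf g := by
  rw [sub_mul, one_mul, X_one_mul_seriesOf, seriesOf_sub]
  simp only [h]

theorem one_sub_X_two_mul {f g : ℕ → ℕ → ℕ → ℚ}
    (h : ∀ a b c, f a b c - (if c = 0 then 0 else f a b (c - 1)) = g a b c) :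
    (1 - MvPowerSeries.X 2) * seriesOf f = seriesOf g := by
  rw [sub_mul, one_mul, X_two_mul_seriesOf, seriesOf_sub]
  simp only [h]

/-- A corner tree forces all sides to be positive, so the restriction to `1 ≤ m i` in `genFun` can
be dropped. -/
theorem genFun_eq_seriesOf {F : (Fin 3 → ℕ) → Finset Cell → Prop}
    {Q : (Fin 3 → ℕ) → Finset Cell → Prop} (h : ∀ n S, F n S ↔ IsCornerTree n S ∧ Q n S) :
    genFun F = seriesOf fun a b c => (treeCount (Q ![a, b, c]) ![a, b, c] : ℚ) := by
  ext m
  have hm : ![m 0, m 1, m 2] = (m : Fin 3 → ℕ) := by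
    ext l; fin_cases l <;> rfl
  rw [coeff_seriesOf, hm]
  have h1 : familyCount F m = treeCount (Q m) m := by
    simp only [familyCount, treeCount, h]
  change (if _ then _ else _) = _
  split_ifs with hm1
  · rw [h1]
  · rw [treeCount_eq_zero fun S hS _ => hm1 hS.one_le, Nat.cast_zero]

theorem forall_vec3 {P : ℕ → Prop} {a b c : ℕ} :
    (∀ i, P ((![a, b, c] : Fin 3 → ℕ) i)) ↔ P a ∧ P b ∧ P c := by
  simp [Fin.forall_fin_succ]

theorem vec3_eq_one {a b c : ℕ} : ![a, b, c] = (1 : Fin 3 → ℕ) ↔ a = 1 ∧ b = 1 ∧ c = 1 := by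
  simp [funext_iff, Fin.forall_fin_succ]

theorem sum_shiftAlong_vec3 (f : (Fin 3 → ℕ) → ℕ) (a b c : ℕ) :
    ∑ i, shiftAlong i f ![a, b, c] = (if a = 0 then 0 else f ![a - 1, b, c]) +
      (if b = 0 then 0 else f ![a, b - 1, c]) + if c = 0 then 0 else f ![a, b, c - 1] := by
  have h0 : ![a, b, c] - Pi.single 0 1 = ![a - 1, b, c] := by
    ext l; fin_cases l <;> simp
  have h1 : ![a, b, c] - Pi.single 1 1 = ![a, b - 1, c] := by
    ext l; fin_cases l <;> simp
  have h2 : ![a, b, c] - Pi.single 2 1 = ![a, b, c - 1] := by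
    ext l; fin_cases l <;> simp
  simp only [Fin.sum_univ_three, shiftAlong, h0, h1, h2]
  rfl

theorem isFlat_vec3 {a b c : ℕ} :
    IsFlat ![a, b, c] ↔ (a = 1 ∧ 2 ≤ b ∧ 2 ≤ c) ∨ (2 ≤ a ∧ b = 1 ∧ 2 ≤ c) ∨
      (2 ≤ a ∧ 2 ≤ b ∧ c = 1) := by
  simp [IsFlat, Fin.exists_fin_succ, Fin.forall_fin_succ]
  tauto

/-! ### The generating functions with denominators cleared -/

theorem genFun_isStair :
    (1 - MvPowerSeries.X 0 - MvPowerSeries.X 1 - MvPowerSeries.X 2) * genFun IsStair =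
      MvPowerSeries.X 0 * MvPowerSeries.X 1 * MvPowerSeries.X 2 := by
  have hm := X_pow_mul_eq_seriesOf 1 1 1
  simp only [pow_one] at hm
  rw [hm, genFun_eq_seriesOf (Q := fun n S => farCorner n ∈ S) fun n S => isStair_iff]
  rw [sub_mul, sub_mul, sub_mul, one_mul, X_zero_mul_seriesOf, X_one_mul_seriesOf,
    X_two_mul_seriesOf, seriesOf_sub, seriesOf_sub, seriesOf_sub]
  congr 1
  ext a b c
  have h := stairCount_rec ![a, b, c]
  rw [sum_shiftAlong_vec3] at h
  simp only [vec3_eq_one] at h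
  have h' := congrArg (Nat.cast (R := ℚ)) h
  push_cast at h'
  rw [h']
  ring

theorem genFun_isTripod :
    (1 - MvPowerSeries.X 0) * ((1 - MvPowerSeries.X 1) * ((1 - MvPowerSeries.X 2) *
      genFun IsTripod)) = MvPowerSeries.X 0 ^ 2 * MvPowerSeries.X 1 ^ 2 * MvPowerSeries.X 2 ^ 2 := by
  have h : genFun IsTripod = seriesOf fun a b c =>
      if 2 ≤ c then if 2 ≤ b then if 2 ≤ a then 1 else 0 else 0 else 0 := by
    rw [genFun_eq_seriesOf fun n S => isTripod_iff]
    congr 1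
    ext a b c
    rw [treeCount_univ]
    simp only [forall_vec3]
    split_ifs <;> simp <;> omega
  rw [h, one_sub_X_two_mul (g := fun a b c => if 2 ≤ a ∧ 2 ≤ b ∧ c = 2 then 1 else 0),
    one_sub_X_one_mul (g := fun a b c => if 2 ≤ a ∧ b = 2 ∧ c = 2 then 1 else 0),
    one_sub_X_zero_mul (g := fun a b c => if a = 2 ∧ b = 2 ∧ c = 2 then 1 else 0),
    X_pow_mul_eq_seriesOf] <;>
  · intro a b c
    split_ifs <;> first | (exfalso; omega) | norm_num

open Classical in
theorem genFun_isFlatHook : ∃ H₀ H₁ H₂ : MvPowerSeries (Fin 3) ℚ,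
    genFun IsFlatHook = H₀ + H₁ + H₂ ∧
      (1 - MvPowerSeries.X 1) * ((1 - MvPowerSeries.X 2) * H₀) =
        MvPowerSeries.X 0 ^ 1 * MvPowerSeries.X 1 ^ 2 * MvPowerSeries.X 2 ^ 2 ∧
      (1 - MvPowerSeries.X 0) * ((1 - MvPowerSeries.X 2) * H₁) =
        MvPowerSeries.X 0 ^ 2 * MvPowerSeries.X 1 ^ 1 * MvPowerSeries.X 2 ^ 2 ∧
      (1 - MvPowerSeries.X 0) * ((1 - MvPowerSeries.X 1) * H₂) =
        MvPowerSeries.X 0 ^ 2 * MvPowerSeries.X 1 ^ 2 * MvPowerSeries.X 2 ^ 1 := by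
  refine ⟨seriesOf fun a b c => if a = 1 ∧ 2 ≤ b ∧ 2 ≤ c then 1 else 0,
    seriesOf fun a b c => if 2 ≤ a ∧ b = 1 ∧ 2 ≤ c then 1 else 0,
    seriesOf fun a b c => if 2 ≤ a ∧ 2 ≤ b ∧ c = 1 then 1 else 0, ?_, ?_, ?_, ?_⟩
  · rw [genFun_eq_seriesOf fun n S => isFlatHook_iff, seriesOf_add, seriesOf_add]
    congr 1
    ext a b c
    rw [treeCount_flat]
    simp only [isFlat_vec3]
    split_ifs <;> first | (exfalso; omega) | norm_num
  · rw [one_sub_X_two_mul (g := fun a b c => if a = 1 ∧ 2 ≤ b ∧ c = 2 then 1 else 0),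
      one_sub_X_one_mul (g := fun a b c => if a = 1 ∧ b = 2 ∧ c = 2 then 1 else 0),
      X_pow_mul_eq_seriesOf] <;>
    · intro a b c
      split_ifs <;> first | (exfalso; omega) | norm_num
  · rw [one_sub_X_two_mul (g := fun a b c => if 2 ≤ a ∧ b = 1 ∧ c = 2 then 1 else 0),
      one_sub_X_zero_mul (g := fun a b c => if a = 2 ∧ b = 1 ∧ c = 2 then 1 else 0),
      X_pow_mul_eq_seriesOf] <;>
    · intro a b c
      split_ifs <;> first | (exfalso; omega) | norm_num
  · rw [one_sub_X_one_mul (g := fun a b c => if 2 ≤ a ∧ b = 2 ∧ c = 1 then 1 else 0),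
      one_sub_X_zero_mul (g := fun a b c => if a = 2 ∧ b = 2 ∧ c = 1 then 1 else 0),
      X_pow_mul_eq_seriesOf] <;>
    · intro a b c
      split_ifs <;> first | (exfalso; omega) | norm_num

/-- This is `cornerCount_rec` read coefficientwise: the shifts are multiplications by the variables,
and the trees with two corner directions split into `Deg2` and flat hooks. -/
theorem genFun_isCornerPolyomino :
    (1 - MvPowerSeries.X 0 - MvPowerSeries.X 1 - MvPowerSeries.X 2) * genFun IsCornerPolyomino =
      MvPowerSeries.X 0 * MvPowerSeries.X 1 * MvPowerSeries.X 2 + genFun IsTripod +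
        genFun IsDegTwoCorner + genFun IsFlatHook := by
  classical
  have hm := X_pow_mul_eq_seriesOf 1 1 1
  simp only [pow_one] at hm
  rw [hm, genFun_eq_seriesOf (F := IsCornerPolyomino) (Q := fun n S => True)
    fun n S => by rw [isCornerPolyomino_iff, and_true], genFun_eq_seriesOf fun n S => isTripod_iff,
    genFun_eq_seriesOf fun n S => isDegTwoCorner_iff, genFun_eq_seriesOf fun n S => isFlatHook_iff,
    sub_mul, sub_mul, sub_mul, one_mul, X_zero_mul_seriesOf, X_one_mul_seriesOf,
    X_two_mul_seriesOf, seriesOf_sub, seriesOf_sub, seriesOf_sub, seriesOf_add, seriesOf_add,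
    seriesOf_add]
  congr 1
  ext a b c
  have h := cornerCount_rec ![a, b, c]
  rw [sum_treeCount_pair, ← treeCount_univ, ← treeCount_flat, sum_shiftAlong_vec3] at h
  simp only [vec3_eq_one] at h
  have h' := congrArg (Nat.cast (R := ℚ)) h
  push_cast at h'
  rw [h']
  ring

/-! ### Planar corner counts and the series of `Deg2` -/

open Classical in
theorem cornerCount_planar_rec {a b c : ℕ} (h : a = 1 ∨ b = 1 ∨ c = 1) :
    cornerCount ![a, b, c] = (if a = 1 ∧ b = 1 ∧ c = 1 then 1 else 0) +
      ((if a = 0 then 0 else cornerCount ![a - 1, b, c]) +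
      (if b = 0 then 0 else cornerCount ![a, b - 1, c]) +
      if c = 0 then 0 else cornerCount ![a, b, c - 1]) +
      if IsFlat ![a, b, c] then 1 else 0 := by
  have hn : ¬ ∀ i, 2 ≤ (![a, b, c] : Fin 3 → ℕ) i := by
    rw [forall_vec3 (P := fun m => 2 ≤ m)]; omega
  rw [cornerCount_rec, sum_treeCount_pair, sum_shiftAlong_vec3, if_neg hn,
    treeCount_eq_zero fun S _ hS => hn hS.1]
  simp only [vec3_eq_one]
  ring

theorem cornerCount_zero_left (b c : ℕ) : cornerCount ![0, b, c] = 0 :=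
  cornerCount_eq_zero (i := 0) rfl

theorem cornerCount_zero_mid (a c : ℕ) : cornerCount ![a, 0, c] = 0 :=
  cornerCount_eq_zero (i := 1) rfl

theorem cornerCount_zero_right (a b : ℕ) : cornerCount ![a, b, 0] = 0 :=
  cornerCount_eq_zero (i := 2) rfl

theorem cornerCount_row_left (a : ℕ) : cornerCount ![a + 1, 1, 1] = 1 := by
  induction a with
  | zero =>
    rw [cornerCount_planar_rec (by simp)]
    simp [isFlat_vec3, cornerCount_zero_left, cornerCount_zero_mid, cornerCount_zero_right]
  | succ a ih =>
    rw [cornerCount_planar_rec (by simp)]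
    simp [isFlat_vec3, cornerCount_zero_mid, cornerCount_zero_right, ih]

theorem cornerCount_row_mid (b : ℕ) : cornerCount ![1, b + 1, 1] = 1 := by
  induction b with
  | zero => exact cornerCount_row_left 0
  | succ b ih =>
    rw [cornerCount_planar_rec (by simp)]
    simp [isFlat_vec3, cornerCount_zero_left, cornerCount_zero_right, ih]

theorem cornerCount_row_right (c : ℕ) : cornerCount ![1, 1, c + 1] = 1 := by
  induction c with
  | zero => exact cornerCount_row_left 0
  | succ c ih =>
    rw [cornerCount_planar_rec (by simp)]
    simp [isFlat_vec3, cornerCount_zero_left, cornerCount_zero_mid, ih]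

theorem cornerCount_plane_left (b c : ℕ) : cornerCount ![1, b + 2, c + 2] =
    cornerCount ![1, b + 1, c + 2] + cornerCount ![1, b + 2, c + 1] + 1 := by
  rw [cornerCount_planar_rec (by simp)]
  simp [isFlat_vec3, cornerCount_zero_left]

theorem cornerCount_plane_mid (a c : ℕ) : cornerCount ![a + 2, 1, c + 2] =
    cornerCount ![a + 1, 1, c + 2] + cornerCount ![a + 2, 1, c + 1] + 1 := by
  rw [cornerCount_planar_rec (by simp)]
  simp [isFlat_vec3, cornerCount_zero_mid]

theorem cornerCount_plane_right (a b : ℕ) : cornerCount ![a + 2, b + 2, 1] =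
    cornerCount ![a + 1, b + 2, 1] + cornerCount ![a + 2, b + 1, 1] + 1 := by
  rw [cornerCount_planar_rec (by simp)]
  simp [isFlat_vec3, cornerCount_zero_right]

theorem two_mul_X_pow_eq_seriesOf (i j k : ℕ) :
    (2 * (MvPowerSeries.X 0 ^ i * MvPowerSeries.X 1 ^ j * MvPowerSeries.X 2 ^ k) :
      MvPowerSeries (Fin 3) ℚ) = seriesOf fun a b c => if a = i ∧ b = j ∧ c = k then 2 else 0 := by
  rw [X_pow_mul_eq_seriesOf, two_mul, seriesOf_add]
  congr 1
  ext a b c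
  split_ifs <;> norm_num

theorem genFun_isDegTwoCorner : ∃ D₀ D₁ D₂ : MvPowerSeries (Fin 3) ℚ,
    genFun IsDegTwoCorner = D₀ + D₁ + D₂ ∧
      (1 - MvPowerSeries.X 1) * ((1 - MvPowerSeries.X 2) * ((1 - MvPowerSeries.X 1 -
        MvPowerSeries.X 2) * ((1 - MvPowerSeries.X 0) * D₀))) =
        2 * (MvPowerSeries.X 0 ^ 2 * MvPowerSeries.X 1 ^ 2 * MvPowerSeries.X 2 ^ 2) ∧
      (1 - MvPowerSeries.X 0) * ((1 - MvPowerSeries.X 2) * ((1 - MvPowerSeries.X 0 -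
        MvPowerSeries.X 2) * ((1 - MvPowerSeries.X 1) * D₁))) =
        2 * (MvPowerSeries.X 0 ^ 2 * MvPowerSeries.X 1 ^ 2 * MvPowerSeries.X 2 ^ 2) ∧
      (1 - MvPowerSeries.X 0) * ((1 - MvPowerSeries.X 1) * ((1 - MvPowerSeries.X 0 -
        MvPowerSeries.X 1) * ((1 - MvPowerSeries.X 2) * D₂))) =
        2 * (MvPowerSeries.X 0 ^ 2 * MvPowerSeries.X 1 ^ 2 * MvPowerSeries.X 2 ^ 2) := by
  -- One series for each axis carrying the row. The coefficient counts the planar corner trees other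
  -- than the hook and does not depend on the length of the row.
  refine ⟨seriesOf fun a b c => if 2 ≤ a ∧ 2 ≤ b ∧ 2 ≤ c then cornerCount ![1, b, c] - 1 else 0,
    seriesOf fun a b c => if 2 ≤ a ∧ 2 ≤ b ∧ 2 ≤ c then cornerCount ![a, 1, c] - 1 else 0,
    seriesOf fun a b c => if 2 ≤ a ∧ 2 ≤ b ∧ 2 ≤ c then cornerCount ![a, b, 1] - 1 else 0,
    ?_, ?_, ?_, ?_⟩
  · rw [genFun_eq_seriesOf fun n S => isDegTwoCorner_iff, seriesOf_add, seriesOf_add]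
    congr 1
    ext a b c
    by_cases hn : ∀ i, 2 ≤ (![a, b, c] : Fin 3 → ℕ) i
    · have h := congrArg (Nat.cast (R := ℚ)) (treeCount_card_eq_two_add hn)
      have h0 : Function.update ![a, b, c] 0 1 = ![1, b, c] := by
        ext l; fin_cases l <;> simp
      have h1 : Function.update ![a, b, c] 1 1 = ![a, 1, c] := by
        ext l; fin_cases l <;> simp
      have h2 : Function.update ![a, b, c] 2 1 = ![a, b, 1] := by
        ext l; fin_cases l <;> simp
      rw [Fin.sum_univ_three, h0, h1, h2] at h
      push_cast at h
      have hn' := (forall_vec3 (P := fun m => 2 ≤ m)).1 hn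
      simp only [hn', and_self, if_true]
      linarith
    · rw [treeCount_eq_zero fun S _ hS => hn hS.1]
      rw [forall_vec3 (P := fun m => 2 ≤ m)] at hn
      simp [hn]
  -- The planar count `f` satisfies `f = f' + f'' + 1`, so `f - 1` satisfies the same recurrence
  -- with source `2`. It vanishes when a side has length one, as `f = 1` there, which agrees with
  -- the default value `0`. The condition `a = 2` is what remains after multiplication by `1 - X 0`.
  · have hq : (1 - MvPowerSeries.X 1 - MvPowerSeries.X 2) * seriesOf (fun a b c =>
        if a = 2 ∧ 2 ≤ b ∧ 2 ≤ c then (cornerCount ![1, b, c] : ℚ) - 1 else 0) =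
        seriesOf fun a b c => if a = 2 ∧ 2 ≤ b ∧ 2 ≤ c then 2 else 0 := by
      rw [sub_mul, sub_mul, one_mul, X_one_mul_seriesOf, X_two_mul_seriesOf, seriesOf_sub,
        seriesOf_sub]
      congr 1
      ext a b c
      rcases b with _ | _ | b
      · simp
      · simp
      rcases c with _ | _ | c
      · simp
      · simp
      have h := cornerCount_plane_left b c
      have h1 := cornerCount_row_mid
      have h2 := cornerCount_row_right
      by_cases h3 : a = 2 <;> rcases b with _ | b <;> rcases c with _ | c <;>
        simp_all <;> ring
    rw [one_sub_X_zero_mul (g := fun a b c =>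
        if a = 2 ∧ 2 ≤ b ∧ 2 ≤ c then (cornerCount ![1, b, c] : ℚ) - 1 else 0), hq,
      one_sub_X_two_mul (g := fun a b c => if a = 2 ∧ 2 ≤ b ∧ c = 2 then 2 else 0),
      one_sub_X_one_mul (g := fun a b c => if a = 2 ∧ b = 2 ∧ c = 2 then 2 else 0),
      two_mul_X_pow_eq_seriesOf] <;>
    · intro a b c
      split_ifs <;> first | (exfalso; omega) | norm_num
  · have hq : (1 - MvPowerSeries.X 0 - MvPowerSeries.X 2) * seriesOf (fun a b c =>
        if 2 ≤ a ∧ b = 2 ∧ 2 ≤ c then (cornerCount ![a, 1, c] : ℚ) - 1 else 0) =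
        seriesOf fun a b c => if 2 ≤ a ∧ b = 2 ∧ 2 ≤ c then 2 else 0 := by
      rw [sub_mul, sub_mul, one_mul, X_zero_mul_seriesOf, X_two_mul_seriesOf, seriesOf_sub,
        seriesOf_sub]
      congr 1
      ext a b c
      rcases a with _ | _ | a
      · simp
      · simp
      rcases c with _ | _ | c
      · simp
      · simp
      have h := cornerCount_plane_mid a c
      have h1 := cornerCount_row_left
      have h2 := cornerCount_row_right
      by_cases h3 : b = 2 <;> rcases a with _ | a <;> rcases c with _ | c <;>
        simp_all <;> ring
    rw [one_sub_X_one_mul (g := fun a b c =>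
        if 2 ≤ a ∧ b = 2 ∧ 2 ≤ c then (cornerCount ![a, 1, c] : ℚ) - 1 else 0), hq,
      one_sub_X_two_mul (g := fun a b c => if 2 ≤ a ∧ b = 2 ∧ c = 2 then 2 else 0),
      one_sub_X_zero_mul (g := fun a b c => if a = 2 ∧ b = 2 ∧ c = 2 then 2 else 0),
      two_mul_X_pow_eq_seriesOf] <;>
    · intro a b c
      split_ifs <;> first | (exfalso; omega) | norm_num
  · have hq : (1 - MvPowerSeries.X 0 - MvPowerSeries.X 1) * seriesOf (fun a b c =>
        if 2 ≤ a ∧ 2 ≤ b ∧ c = 2 then (cornerCount ![a, b, 1] : ℚ) - 1 else 0) =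
        seriesOf fun a b c => if 2 ≤ a ∧ 2 ≤ b ∧ c = 2 then 2 else 0 := by
      rw [sub_mul, sub_mul, one_mul, X_zero_mul_seriesOf, X_one_mul_seriesOf, seriesOf_sub,
        seriesOf_sub]
      congr 1
      ext a b c
      rcases a with _ | _ | a
      · simp
      · simp
      rcases b with _ | _ | b
      · simp
      · simp
      have h := cornerCount_plane_right a b
      have h1 := cornerCount_row_left
      have h2 := cornerCount_row_mid
      by_cases h3 : c = 2 <;> rcases a with _ | a <;> rcases b with _ | b <;>
        simp_all <;> ring
    rw [one_sub_X_two_mul (g := fun a b c =>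
        if 2 ≤ a ∧ 2 ≤ b ∧ c = 2 then (cornerCount ![a, b, 1] : ℚ) - 1 else 0), hq,
      one_sub_X_one_mul (g := fun a b c => if 2 ≤ a ∧ b = 2 ∧ c = 2 then 2 else 0),
      one_sub_X_zero_mul (g := fun a b c => if a = 2 ∧ b = 2 ∧ c = 2 then 2 else 0),
      two_mul_X_pow_eq_seriesOf] <;>
    · intro a b c
      split_ifs <;> first | (exfalso; omega) | norm_num

/-! ### Division in the field of fractions -/

theorem toSeriesField_ne_zero {f : MvPowerSeries (Fin 3) ℚ} {m : Fin 3 →₀ ℕ}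
    (h : MvPowerSeries.coeff m f ≠ 0) : toSeriesField f ≠ 0 := by
  rw [toSeriesField, map_ne_zero_iff _ (IsFractionRing.injective _ SeriesField)]
  rintro rfl
  exact h (map_zero _)

theorem mainTheorem4 (x y z : SeriesField)
    (hx : x = toSeriesField (MvPowerSeries.X 0))
    (hy : y = toSeriesField (MvPowerSeries.X 1))
    (hz : z = toSeriesField (MvPowerSeries.X 2)) :
    toSeriesField (genFun IsCornerPolyomino) =
        stairFun x y z *
          (1 + (tripodFun x y z + degTwoFun x y z + hookFun x y z) / (x * y * z)) ∧
      toSeriesField (genFun IsStair) = stairFun x y z ∧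
      toSeriesField (genFun IsTripod) = tripodFun x y z ∧
      toSeriesField (genFun IsDegTwoCorner) = degTwoFun x y z ∧
      toSeriesField (genFun IsFlatHook) = hookFun x y z := by
  have hX : ∀ i : Fin 3, toSeriesField (MvPowerSeries.X i) ≠ 0 := fun i =>
    toSeriesField_ne_zero (m := Finsupp.single i 1) (by simp [MvPowerSeries.coeff_X])
  have hx0 : x ≠ 0 := hx ▸ hX 0
  have hy0 : y ≠ 0 := hy ▸ hX 1
  have hz0 : z ≠ 0 := hz ▸ hX 2
  have h1 : ∀ i : Fin 3, 1 - toSeriesField (MvPowerSeries.X i) ≠ 0 := fun i => by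
    rw [← map_one toSeriesField, ← map_sub]
    exact toSeriesField_ne_zero (m := 0) (by simp)
  have hx1 : 1 - x ≠ 0 := hx ▸ h1 0
  have hy1 : 1 - y ≠ 0 := hy ▸ h1 1
  have hz1 : 1 - z ≠ 0 := hz ▸ h1 2
  have h2 : ∀ i j : Fin 3,
      1 - toSeriesField (MvPowerSeries.X i) - toSeriesField (MvPowerSeries.X j) ≠ 0 := fun i j => by
    rw [← map_one toSeriesField, ← map_sub, ← map_sub]
    exact toSeriesField_ne_zero (m := 0) (by simp)
  have hyz : 1 - y - z ≠ 0 := hy ▸ hz ▸ h2 1 2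
  have hxz : 1 - x - z ≠ 0 := hx ▸ hz ▸ h2 0 2
  have hxy : 1 - x - y ≠ 0 := hx ▸ hy ▸ h2 0 1
  have hxyz : 1 - x - y - z ≠ 0 := by
    rw [hx, hy, hz, ← map_one toSeriesField, ← map_sub, ← map_sub, ← map_sub]
    exact toSeriesField_ne_zero (m := 0) (by simp)
  have hstair : toSeriesField (genFun IsStair) = stairFun x y z := by
    have h := congrArg toSeriesField genFun_isStair
    simp only [map_mul, map_sub, map_one, ← hx, ← hy, ← hz] at h
    rw [stairFun, eq_div_iff hxyz, mul_comm, h]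
  have htripod : toSeriesField (genFun IsTripod) = tripodFun x y z := by
    have h := congrArg toSeriesField genFun_isTripod
    simp only [map_mul, map_sub, map_one, map_pow, ← hx, ← hy, ← hz] at h
    rw [tripodFun, eq_div_iff (by positivity), ← h]
    ring
  have hhook : toSeriesField (genFun IsFlatHook) = hookFun x y z := by
    obtain ⟨H₀, H₁, H₂, hH, h₀, h₁, h₂⟩ := genFun_isFlatHook
    have h₀ := congrArg toSeriesField h₀
    have h₁ := congrArg toSeriesField h₁
    have h₂ := congrArg toSeriesField h₂
    simp only [map_mul, map_sub, map_one, map_pow, ← hx, ← hy, ← hz] at h₀ h₁ h₂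
    have e₀ : toSeriesField H₀ = x * y ^ 2 * z ^ 2 / ((1 - z) * (1 - y)) := by
      rw [eq_div_iff (mul_ne_zero hz1 hy1)]; linear_combination h₀
    have e₁ : toSeriesField H₁ = x ^ 2 * y * z ^ 2 / ((1 - x) * (1 - z)) := by
      rw [eq_div_iff (mul_ne_zero hx1 hz1)]; linear_combination h₁
    have e₂ : toSeriesField H₂ = x ^ 2 * y ^ 2 * z / ((1 - x) * (1 - y)) := by
      rw [eq_div_iff (mul_ne_zero hx1 hy1)]; linear_combination h₂
    rw [hH, map_add, map_add, e₀, e₁, e₂, hookFun]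
    ring
  have hdeg : toSeriesField (genFun IsDegTwoCorner) = degTwoFun x y z := by
    obtain ⟨D₀, D₁, D₂, hD, h₀, h₁, h₂⟩ := genFun_isDegTwoCorner
    have h₀ := congrArg toSeriesField h₀
    have h₁ := congrArg toSeriesField h₁
    have h₂ := congrArg toSeriesField h₂
    simp only [map_mul, map_sub, map_one, map_pow, map_ofNat, ← hx, ← hy, ← hz] at h₀ h₁ h₂
    -- The difference of the two fractions has numerator `2yz · yz`, because `(1 - y)(1 - z) - (1 -
    -- y - z) = yz`.
    have key : ∀ x y z d : SeriesField, 1 - x ≠ 0 → 1 - y ≠ 0 → 1 - z ≠ 0 → 1 - y - z ≠ 0 →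
        (1 - y) * ((1 - z) * ((1 - y - z) * ((1 - x) * d))) = 2 * (x ^ 2 * y ^ 2 * z ^ 2) →
        d = (2 * y * z / (1 - y - z) - 2 * y * z / ((1 - y) * (1 - z))) * (x ^ 2 / (1 - x)) := by
      intro x y z d hx hy hz hyz h
      field_simp
      linear_combination h
    rw [hD, map_add, map_add, key x y z (toSeriesField D₀) hx1 hy1 hz1 hyz h₀,
      key y x z (toSeriesField D₁) hy1 hx1 hz1 hxz (by linear_combination h₁),
      key z x y (toSeriesField D₂) hz1 hx1 hy1 hxy (by linear_combination h₂), degTwoFun]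
  refine ⟨?_, hstair, htripod, hdeg, hhook⟩
  have h := congrArg toSeriesField genFun_isCornerPolyomino
  simp only [map_mul, map_sub, map_one, map_add, ← hx, ← hy, ← hz] at h
  rw [htripod, hdeg, hhook] at h
  rw [stairFun]
  generalize tripodFun x y z = t at *
  generalize degTwoFun x y z = d at *
  generalize hookFun x y z = k at *
  field_simp
  linear_combination h
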